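/- **Lemma (unisolvence of the degrees of freedom of $\mathcal P_{2,p}\Lambda^1(\mathcal T_h^3)$).** Let $p\ge 3$ be an integer and let $t\subset\mathbb R^3$ be a nondegenerate (closed) tetrahedron; for each face $f$ of $t$ let $\bm\nu_f$ be a unit normal of $f$ (either orientation). For an edge, a face or the tetrahedron $s$, let $\mathcal P_m(s)$ be the space of restrictions to $s$ of real polynomials of degree at most $m$ (with $\mathcal P_m(s)=\{0\}$ if $m<0$); let $(\mathcal P_m(f))^2$ denote the vector fields on the face $f$ with components in $\mathcal P_m(f)$ and values in the two-dimensional plane of directions of $f$; and let $$\mathcal P^-_{r}\Lambda^2(t)=\{\,\bm a+b\,\bm x:\ \bm a\in(\mathcal P_{r-1}(t))^3,\ b\in\mathcal P_{r-1}(t)\,\}$$ be the space of Raviart–Thomas fields of degree $r$. Consider, for $\bm E\in(\mathcal P_p(t))^3$, the degrees of freedom 1. $\bm E_i(\bm x)$ and $\partial_j\bm E_i(\bm x)$, $i,j=1,2,3$, at each vertex $\bm x$ of $t$; 2. $\displaystyle\int_e \bm E_i\,q\,ds$, $q\in\mathcal P_{p-4}(e)$, $i=1,2,3$, on each edge $e$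 of $t$; 3. $\displaystyle\int_f(\bm E\times\bm\nu_f)\cdot\bm q\,dA$, $\bm q\in(\mathcal P_{p-3}(f))^2$, on each face $f$ of $t$; 4. $\displaystyle\int_t\bm E\cdot\bm v\,dx$, $\bm v\in\mathcal P^-_{p-2}\Lambda^2(t)$. These degrees of freedom are unisolvent for $(\mathcal P_p(t))^3$: for all prescribed vertex values and first derivatives, and all prescribed linear functionals on the test spaces in 2 (one for each edge and each component $i$), 3 (one for each face) and 4, there is exactly one $\bm E\in(\mathcal P_p(t))^3$ whose degrees of freedom have the prescribed values. Equivalently, after choosing bases of the test spaces, the degrees of freedom form a basis of the dual space of $(\mathcal P_p(t))^3$. -/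

import Mathlib

open MeasureTheory

noncomputable section

/-- Euclidean three-space. -/
abbrev E3 : Type := EuclideanSpace ℝ (Fin 3)

/-- Real polynomials in three variables of total degree at most `m`; this is the zero space
when `m < 0`. -/
def polySpace (m : ℤ) : Submodule ℝ (MvPolynomial (Fin 3) ℝ) :=
  MvPolynomial.restrictSupport ℝ {d : Fin 3 →₀ ℕ | ((Finsupp.degree d : ℕ) : ℤ) ≤ m}

/-- The shape functions: vector polynomials on three-space, each of whose components has degree
at most `p`. -/
abbrev VecPoly (p : ℕ) : Type := Fin 3 → polySpace (p : ℤ)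

/-- The value of a vector polynomial at a point. -/
def VecPoly.at {p : ℕ} (E : VecPoly p) (x : E3) : E3 :=
  WithLp.toLp 2 fun i => MvPolynomial.eval x.ofLp (E i).1

/-- The value of the partial derivative of the `i`-th component in the direction of the `j`-th
coordinate. -/
def VecPoly.derivAt {p : ℕ} (E : VecPoly p) (i j : Fin 3) (x : E3) : ℝ :=
  MvPolynomial.eval x.ofLp (MvPolynomial.pderiv j (E i).1)

/-- Restriction of polynomials to a set, as a linear map into the functions on that set. -/
def restrictTo (S : Set E3) : MvPolynomial (Fin 3) ℝ →ₗ[ℝ] (S → ℝ) :=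
  LinearMap.pi fun x => (MvPolynomial.aeval x.1.ofLp).toLinearMap

/-- Polynomial functions of degree at most `m` on the set `S` (a segment, a triangle or a
tetrahedron below): the restrictions to `S` of polynomials of degree at most `m`. -/
def polyOn (S : Set E3) (m : ℤ) : Submodule ℝ (S → ℝ) :=
  (polySpace m).map (restrictTo S)

/-- Vector fields on `S` all of whose components are polynomial of degree at most `m`. -/
def vecPolyOn (S : Set E3) (m : ℤ) : Submodule ℝ (S → E3) where
  carrier := {q | ∀ i : Fin 3, (fun x => q x i) ∈ polyOn S m}
  add_mem' := fun ha hb i => (polyOn S m).add_mem (ha i) (hb i)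
  zero_mem' := fun _ => (polyOn S m).zero_mem
  smul_mem' := fun c _ ha i => (polyOn S m).smul_mem c (ha i)

/-- Tangential polynomial vector fields of degree at most `m` on a triangle. In any basis of the
plane of the triangle these are the pairs of polynomials of degree at most `m` on it. -/
def tangentPolyOn (F : Affine.Simplex ℝ E3 2) (m : ℤ) : Submodule ℝ (F.closedInterior → E3) where
  carrier := {q | q ∈ vecPolyOn F.closedInterior m ∧
    ∀ x, q x ∈ (affineSpan ℝ (Set.range F.points)).direction}
  add_mem' := fun ha hb =>
    ⟨Submodule.add_mem _ ha.1 hb.1, fun x => Submodule.add_mem _ (ha.2 x) (hb.2 x)⟩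
  zero_mem' := ⟨Submodule.zero_mem _, fun _ => Submodule.zero_mem _⟩
  smul_mem' := fun c _ ha =>
    ⟨Submodule.smul_mem _ c ha.1, fun x => Submodule.smul_mem _ c (ha.2 x)⟩

/-- Multiplication of a scalar function on `S` by the position vector. -/
def mulPosition (S : Set E3) : (S → ℝ) →ₗ[ℝ] (S → E3) where
  toFun b := fun x => b x • x.1
  map_add' a b := by
    funext x
    simp [add_smul]
  map_smul' c a := by
    funext x
    simp [mul_smul]

/-- The space of trimmed polynomial two-forms of degree `r` on `S`, written as vector fields: the
Raviart-Thomas fields `a(x) + b(x) x` with `a`, `b` polynomial of degree at most `r - 1`. -/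
def trimmedTwoForms (S : Set E3) (r : ℤ) : Submodule ℝ (S → E3) :=
  vecPolyOn S (r - 1) ⊔ (polyOn S (r - 1)).map (mulPosition S)

/-- The `d`-dimensional Euclidean measure (length, area or volume) on a closed `d`-simplex. -/
def simplexMeasure {d : ℕ} (F : Affine.Simplex ℝ E3 d) : Measure F.closedInterior :=
  Measure.comap Subtype.val (μHE[d] : Measure E3)

/-- The edges of a tetrahedron, as pairs of vertex labels. -/
abbrev TetEdge : Type := {e : Finset (Fin 4) // e.card = 2}

/-- The faces of a tetrahedron, as triples of vertex labels. -/
abbrev TetFace : Type := {f : Finset (Fin 4) // f.card = 3}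

/-- The edge of `T` with label `e`. -/
def tetEdge (T : Affine.Simplex ℝ E3 3) (e : TetEdge) : Affine.Simplex ℝ E3 1 := T.face e.2

/-- The face of `T` with label `f`. -/
def tetFace (T : Affine.Simplex ℝ E3 3) (f : TetFace) : Affine.Simplex ℝ E3 2 := T.face f.2

/-- The cross product on Euclidean three-space. -/
def cross (a b : E3) : E3 := WithLp.toLp 2 (crossProduct a.ofLp b.ofLp)

/-- `n` is one of the two unit normals of the triangle `F`. -/
def IsUnitNormal (F : Affine.Simplex ℝ E3 2) (n : E3) : Prop :=
  ‖n‖ = 1 ∧ ∀ w ∈ (affineSpan ℝ (Set.range F.points)).direction, inner ℝ n w = 0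

/-- The moment of the `i`-th component of `E` on the edge `e` against `q`. -/
def edgeMoment (T : Affine.Simplex ℝ E3 3) {p : ℕ} (E : VecPoly p) (e : TetEdge) (i : Fin 3)
    (q : (tetEdge T e).closedInterior → ℝ) : ℝ :=
  ∫ x, E.at x.1 i * q x ∂(simplexMeasure (tetEdge T e))

/-- The moment of `E × n` on the face `f` against the tangential field `q`. -/
def faceMoment (T : Affine.Simplex ℝ E3 3) {p : ℕ} (E : VecPoly p) (f : TetFace) (n : E3)
    (q : (tetFace T f).closedInterior → E3) : ℝ :=
  ∫ x, inner ℝ (cross (E.at x.1) n) (q x) ∂(simplexMeasure (tetFace T f))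

/-- The moment of `E` on the tetrahedron against the field `v`. -/
def interiorMoment (T : Affine.Simplex ℝ E3 3) {p : ℕ} (E : VecPoly p)
    (v : T.closedInterior → E3) : ℝ :=
  ∫ x, inner ℝ (E.at x.1) (v x) ∂(simplexMeasure T)

/-- Prescribed values for all the degrees of freedom of the element on `T`. For the moments these
are linear functionals on the spaces of test functions, that is, one number for each element of
a basis of each of these spaces. -/
structure DofData (T : Affine.Simplex ℝ E3 3) (p : ℕ) where
  vertexValue : Fin 4 → Fin 3 → ℝ
  vertexDeriv : Fin 4 → Fin 3 → Fin 3 → ℝ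
  edge : (e : TetEdge) → Fin 3 →
    Module.Dual ℝ (polyOn (tetEdge T e).closedInterior ((p : ℤ) - 4))
  face : (f : TetFace) → Module.Dual ℝ (tangentPolyOn (tetFace T f) ((p : ℤ) - 3))
  interior : Module.Dual ℝ (trimmedTwoForms T.closedInterior ((p : ℤ) - 2))

/-- The degrees of freedom of `E` have the prescribed values. -/
structure DofData.IsAttainedBy {T : Affine.Simplex ℝ E3 3} {p : ℕ} (D : DofData T p)
    (n : TetFace → E3) (E : VecPoly p) : Prop where
  vertexValue : ∀ a i, E.at (T.points a) i = D.vertexValue a i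
  vertexDeriv : ∀ a i j, E.derivAt i j (T.points a) = D.vertexDeriv a i j
  edge : ∀ e i (q : polyOn (tetEdge T e).closedInterior ((p : ℤ) - 4)),
    edgeMoment T E e i q.1 = D.edge e i q
  face : ∀ f (q : tangentPolyOn (tetFace T f) ((p : ℤ) - 3)),
    faceMoment T E f (n f) q.1 = D.face f q
  interior : ∀ v : trimmedTwoForms T.closedInterior ((p : ℤ) - 2),
    interiorMoment T E v.1 = D.interior v

end

/-! Injectivity of the linear map from fields to degrees of freedom is combined with a dimension
count. Test spaces are bounded only from above and the polynomial space only from below. Injectivity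
then makes the two dimensions equal and gives surjectivity (`dofMap_injective`,
`finrank_dofSpace_le`).

For injectivity, each component of E is written as a homogeneous polynomial of degree p in the four
barycentric coordinates λ. Vanishing on a face opposite a vertex then becomes divisibility by a
variable. On edges, faces and the tetrahedron in turn, E is tested against a field built from E
itself so that the integrand is continuous and nonnegative; a zero moment forces it to vanish
pointwise.

On an edge, double roots at both ends leave t²(1-t)²g, tested against g (`eval_eq_zero_on_edge`). On
a face, vanishing on the three edges gives E = λ_a λ_b λ_c G, and E × ν is tested against G × ν
(`cross_eq_zero_on_face`).

Inside, let U_i = E · (x_i - x_0) for i = 1, 2, 3. Vanishing tangential traces give U_i = λ_j λ_k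
(λ_i c + λ_0 d_i), {i, j, k} = {1, 2, 3}, with one common c
(`exists_decomposition_of_tangential_trace_eq_zero`). The Raviart–Thomas field v = Σ d_i (x_i - x_0)
+ (c - Σ d_i)(x - x_0) makes E · v a sum of squares with nonnegative weights, and its vanishing
kills every U_i (`eq_zero_of_interiorMoment_eq_zero`). -/

/-! ### Euclidean measure on a simplex -/

/-- Hausdorff measure of dimension d is Lebesgue volume only in a d-dimensional space, so the
simplex is translated into its own direction space, where finiteness and positivity of the measure
are known. -/
theorem Affine.Simplex.exists_isometry_map {d : ℕ} (F : Affine.Simplex ℝ E3 d) :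
    ∃ (G : Affine.Simplex ℝ (affineSpan ℝ (Set.range F.points)).direction d)
      (φ : (affineSpan ℝ (Set.range F.points)).direction →ᵃ[ℝ] E3),
      Isometry φ ∧ F.closedInterior = φ '' G.closedInterior ∧
      Module.finrank ℝ (affineSpan ℝ (Set.range F.points)).direction = d := by
  set S := affineSpan ℝ (Set.range F.points) with hS
  have hmem : ∀ i, F.points i ∈ S := fun i => subset_affineSpan ℝ _ ⟨i, rfl⟩
  let φ : S.direction →ᵃ[ℝ] E3 :=
    (AffineEquiv.vaddConst ℝ (F.points 0)).toAffineMap.comp S.direction.subtype.toAffineMap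
  have hφ : ∀ v : S.direction, φ v = (v : E3) + F.points 0 := fun v => rfl
  have hiso : Isometry φ := by
    refine Isometry.of_dist_eq fun v w => ?_
    rw [hφ, hφ, dist_add_right]
    rfl
  let g : Fin (d + 1) → S.direction := fun i =>
    ⟨F.points i -ᵥ F.points 0, AffineSubspace.vsub_mem_direction (hmem i) (hmem 0)⟩
  have hg : φ ∘ g = F.points := by
    funext i
    simp [hφ, g]
  have hind : AffineIndependent ℝ g := AffineIndependent.of_comp φ (by rw [hg]; exact F.independent)
  have hmap : (Affine.Simplex.mk g hind).map φ hiso.injective = F := by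
    ext i : 1
    exact congrFun hg i
  refine ⟨⟨g, hind⟩, φ, hiso, ?_, ?_⟩
  · rw [← Affine.Simplex.closedInterior_map _ hiso.injective, hmap]
  · rw [hS, direction_affineSpan]
    exact F.independent.finrank_vectorSpan (by simp)

theorem simplexMeasure_preimage {d : ℕ} (F : Affine.Simplex ℝ E3 d) {V : Set E3}
    (hV : MeasurableSet V) :
    simplexMeasure F (Subtype.val ⁻¹' V) = (μHE[d] : Measure E3) (V ∩ F.closedInterior) := by
  have hK : MeasurableSet F.closedInterior := F.isClosed_closedInterior.measurableSet
  rw [simplexMeasure, Measure.comap_apply _ Subtype.val_injective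
    (fun s hs => hK.subtype_image hs) _ (measurable_subtype_coe hV), Subtype.image_preimage_coe,
    Set.inter_comm]

instance simplexMeasure_isFiniteMeasure {d : ℕ} (F : Affine.Simplex ℝ E3 d) :
    IsFiniteMeasure (simplexMeasure F) := by
  obtain ⟨G, φ, hφ, hK, hd⟩ := F.exists_isometry_map
  refine ⟨?_⟩
  rw [← Set.preimage_univ (f := Subtype.val), simplexMeasure_preimage F MeasurableSet.univ,
    Set.univ_inter, hK, hφ.euclideanHausdorffMeasure_image]
  have h := InnerProductSpace.euclideanHausdorffMeasure_eq_volume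
    (V := (affineSpan ℝ (Set.range F.points)).direction)
  rw [hd] at h
  rw [h]
  exact G.isCompact_closedInterior.measure_lt_top

instance simplexMeasure_isOpenPosMeasure {d : ℕ} (F : Affine.Simplex ℝ E3 d) :
    (simplexMeasure F).IsOpenPosMeasure := by
  obtain ⟨G, φ, hφ, hK, hd⟩ := F.exists_isometry_map
  refine ⟨?_⟩
  rintro U hU ⟨⟨x, hx⟩, hxU⟩
  obtain ⟨V, hV, rfl⟩ := isOpen_induced_iff.1 hU
  have hxV : x ∈ V := hxU
  have hinter : V ∩ F.closedInterior = φ '' (φ ⁻¹' V ∩ G.closedInterior) := by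
    rw [hK, Set.image_preimage_inter]
  have h := InnerProductSpace.euclideanHausdorffMeasure_eq_volume
    (V := (affineSpan ℝ (Set.range F.points)).direction)
  rw [hd] at h
  rw [simplexMeasure_preimage F hV.measurableSet, hinter, hφ.euclideanHausdorffMeasure_image, h]
  have hconv : Convex ℝ G.closedInterior := by
    rw [← Affine.Simplex.convexHull_eq_closedInterior]
    exact convex_convexHull ℝ _
  have hint : (interior G.closedInterior).Nonempty := by
    rw [← Affine.Simplex.convexHull_eq_closedInterior,
      interior_convexHull_nonempty_iff_affineSpan_eq_top,
      G.independent.affineSpan_eq_top_iff_card_eq_finrank_add_one, hd, Fintype.card_fin]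
  -- The open set may be given only through a boundary point of the simplex; convexity ensures that
  -- it still meets the interior.
  have hsub : G.closedInterior ⊆ closure (interior G.closedInterior) := by
    rw [hconv.closure_interior_eq_closure_of_nonempty_interior hint]
    exact subset_closure
  obtain ⟨y, hy, rfl⟩ : x ∈ φ '' G.closedInterior := hK ▸ hx
  have hne : (φ ⁻¹' V ∩ interior G.closedInterior).Nonempty :=
    mem_closure_iff.1 (hsub hy) _ (hV.preimage hφ.continuous) hxV
  have hpos := ((hV.preimage hφ.continuous).inter isOpen_interior).measure_pos volume hne
  exact (hpos.trans_le (measure_mono (Set.inter_subset_inter_right _ interior_subset))).ne'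

instance closedInterior_compactSpace {d : ℕ} (F : Affine.Simplex ℝ E3 d) :
    CompactSpace F.closedInterior :=
  isCompact_iff_compactSpace.1 F.isCompact_closedInterior

theorem integrable_simplexMeasure {d : ℕ} (F : Affine.Simplex ℝ E3 d) {g : F.closedInterior → ℝ}
    (hg : Continuous g) : Integrable g (simplexMeasure F) := by
  rw [← integrableOn_univ]
  exact hg.continuousOn.integrableOn_compact isCompact_univ

/-- The measure charges every nonempty relatively open set, so almost everywhere equality of
continuous functions is equality. All three kinds of moments are exploited through this. -/
theorem eq_zero_of_integral_simplexMeasure_eq_zero {d : ℕ} (F : Affine.Simplex ℝ E3 d)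
    {g : F.closedInterior → ℝ} (hg : Continuous g) (h0 : ∀ x, 0 ≤ g x)
    (h : ∫ x, g x ∂(simplexMeasure F) = 0) (x : F.closedInterior) : g x = 0 := by
  rw [integral_eq_zero_iff_of_nonneg h0 (integrable_simplexMeasure F hg)] at h
  exact congrFun ((hg.ae_eq_iff_eq (simplexMeasure F) continuous_zero).1 h) x

/-! ### Homogeneous polynomials and divisibility by variables -/

namespace MvPolynomial

theorem IsHomogeneous.of_X_mul {σ : Type*} {i : σ} {y : MvPolynomial σ ℝ} {n : ℕ}
    (h : (X i * y).IsHomogeneous (n + 1)) : y.IsHomogeneous n := by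
  intro d hd
  have h1 : coeff (d + Finsupp.single i 1) (X i * y) ≠ 0 := by
    rwa [mul_comm, coeff_mul_X]
  have h2 := h h1
  rw [map_add] at h2
  simpa [Finsupp.weight_single] using h2

theorem not_X_dvd_X {σ : Type*} {i j : σ} (h : i ≠ j) :
    ¬ (X i : MvPolynomial σ ℝ) ∣ X j := fun h' => h (X_dvd_X.1 h')

theorem X_dvd_of_dvd_X_mul {σ : Type*} {i j : σ} (hij : i ≠ j) {y : MvPolynomial σ ℝ}
    (h : X i ∣ X j * y) : X i ∣ y :=
  ((X_prime (i := i)).dvd_or_dvd h).resolve_left (not_X_dvd_X hij)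

theorem IsHomogeneous.exists_eq_X_mul {σ : Type*} {i : σ} {y : MvPolynomial σ ℝ} {n : ℕ}
    (h : y.IsHomogeneous (n + 1)) (hd : X i ∣ y) : ∃ z, z.IsHomogeneous n ∧ y = X i * z := by
  obtain ⟨z, rfl⟩ := hd
  exact ⟨z, h.of_X_mul, rfl⟩

theorem IsHomogeneous.eval_smul {σ : Type*} {H : MvPolynomial σ ℝ} {n : ℕ} (h : H.IsHomogeneous n)
    (s : ℝ) (μ : σ → ℝ) : eval (fun a => s * μ a) H = s ^ n * eval μ H := by
  rw [eval_eq, eval_eq, Finset.mul_sum]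
  refine Finset.sum_congr rfl fun d hd => ?_
  simp_rw [mul_pow, Finset.prod_mul_distrib, Finset.prod_pow_eq_pow_sum]
  rw [← h.degree_eq_sum_deg_support hd]
  ring

theorem IsHomogeneous.exists_eq_X_mul_X_mul {σ : Type*} {H : MvPolynomial σ ℝ} {m : ℕ}
    (h : H.IsHomogeneous (m + 2)) {a b : σ} (hab : a ≠ b) (ha : X a ∣ H) (hb : X b ∣ H) :
    ∃ G, G.IsHomogeneous m ∧ H = X a * (X b * G) := by
  obtain ⟨K1, hK1, e1⟩ := IsHomogeneous.exists_eq_X_mul (n := m + 1) h ha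
  rw [e1] at hb
  obtain ⟨K2, hK2, e2⟩ := IsHomogeneous.exists_eq_X_mul hK1 (X_dvd_of_dvd_X_mul hab.symm hb)
  exact ⟨K2, hK2, by rw [e1, e2]⟩

variable {σ : Type*} [DecidableEq σ]

/-- The substitution of `0` for the variables outside `S`. -/
noncomputable def killOutside (S : Finset σ) : MvPolynomial σ ℝ →ₐ[ℝ] MvPolynomial σ ℝ :=
  aeval fun a => if a ∈ S then X a else 0

theorem killOutside_X (S : Finset σ) (a : σ) :
    killOutside S (X a) = if a ∈ S then X a else 0 := by
  simp [killOutside]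

theorem eval_killOutside (S : Finset σ) (μ : σ → ℝ) (H : MvPolynomial σ ℝ) :
    eval μ (killOutside S H) = eval (fun a => if a ∈ S then μ a else 0) H := by
  have : ((aeval μ : MvPolynomial σ ℝ →ₐ[ℝ] ℝ).comp (killOutside S)) =
      aeval (fun a => if a ∈ S then μ a else 0) := by
    ext a
    by_cases h : a ∈ S <;> simp [killOutside_X, h]
  have h2 := congrArg (fun f : MvPolynomial σ ℝ →ₐ[ℝ] ℝ => f H) this
  simpa [aeval_eq_eval] using h2

theorem eval_killOutside_of_support {S : Finset σ} {μ : σ → ℝ} (h : ∀ a ∉ S, μ a = 0)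
    (H : MvPolynomial σ ℝ) : eval μ (killOutside S H) = eval μ H := by
  rw [eval_killOutside]
  congr 2
  funext a
  by_cases ha : a ∈ S <;> simp [ha, h]

theorem IsHomogeneous.killOutside {H : MvPolynomial σ ℝ} {n : ℕ} (h : H.IsHomogeneous n)
    (S : Finset σ) : (killOutside S H).IsHomogeneous n := by
  have := h.aeval (n := 1) (fun a => if a ∈ S then (X a : MvPolynomial σ ℝ) else 0) (fun a => by
    by_cases ha : a ∈ S
    · simpa [ha] using isHomogeneous_X ℝ a
    · simpa [ha] using isHomogeneous_zero σ ℝ 1)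
  rwa [one_mul] at this

theorem killOutside_killOutside (S R : Finset σ) (H : MvPolynomial σ ℝ) :
    killOutside S (killOutside R H) = killOutside (S ∩ R) H := by
  have : (killOutside S).comp (killOutside R) = killOutside (S ∩ R) := by
    ext1 a
    by_cases h : a ∈ R <;> by_cases h' : a ∈ S <;> simp [killOutside_X, h, h']
  exact congrArg (fun f : MvPolynomial σ ℝ →ₐ[ℝ] MvPolynomial σ ℝ => f H) this

/-- The factor theorem for a coordinate hyperplane, by induction on the polynomial. It turns
vanishing on a face into divisibility. -/
theorem X_dvd_sub_killOutside [Fintype σ] (c : σ) (H : MvPolynomial σ ℝ) :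
    X c ∣ H - killOutside (Finset.univ.erase c) H := by
  induction H using MvPolynomial.induction_on with
  | C a => simp [algHom_C]
  | add p q hp hq =>
    rw [map_add, add_sub_add_comm]
    exact dvd_add hp hq
  | mul_X p a hp =>
    rw [map_mul, show p * X a - killOutside (Finset.univ.erase c) p *
        killOutside (Finset.univ.erase c) (X a) =
      (p - killOutside (Finset.univ.erase c) p) * X a + killOutside (Finset.univ.erase c) p *
        (X a - killOutside (Finset.univ.erase c) (X a)) by ring]
    refine dvd_add (hp.mul_right _) (Dvd.dvd.mul_left ?_ _)
    by_cases h : a = c <;> simp [killOutside_X, h]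

theorem X_dvd_of_killOutside_eq_zero [Fintype σ] {c : σ} {H : MvPolynomial σ ℝ}
    (h : killOutside (Finset.univ.erase c) H = 0) : X c ∣ H := by
  simpa [h] using X_dvd_sub_killOutside c H

/-- Homogeneity extends vanishing from the simplex of weights with sum one to the whole positive
cone, a product of infinite sets, where only the zero polynomial vanishes. -/
theorem IsHomogeneous.killOutside_eq_zero [Fintype σ] {H : MvPolynomial σ ℝ} {n : ℕ}
    (h : H.IsHomogeneous n) {S : Finset σ} (hS : S.Nonempty)
    (h0 : ∀ μ : σ → ℝ, (∀ a, 0 ≤ μ a) → (∀ a ∉ S, μ a = 0) → ∑ a, μ a = 1 → eval μ H = 0) :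
    MvPolynomial.killOutside S H = 0 := by
  refine funext_set (fun _ => Set.Ioi (0 : ℝ)) (fun _ => Set.Ioi_infinite 0) fun μ hμ => ?_
  have hμ' : ∀ a, 0 < μ a := fun a => hμ a trivial
  rw [eval_killOutside, map_zero]
  set ν : σ → ℝ := fun a => if a ∈ S then μ a else 0 with hν
  have hν0 : ∀ a, 0 ≤ ν a := fun a => by
    by_cases ha : a ∈ S <;> simp [hν, ha, (hμ' a).le]
  have hs : 0 < ∑ a, ν a := by
    obtain ⟨a, ha⟩ := hS
    exact Finset.sum_pos' (fun a _ => hν0 a) ⟨a, Finset.mem_univ a, by simp [hν, ha, hμ' a]⟩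
  set s := ∑ a, ν a with hsdef
  have key := h0 (fun a => s⁻¹ * ν a) (fun a => mul_nonneg (inv_nonneg.2 hs.le) (hν0 a))
    (fun a ha => by simp [hν, ha]) (by rw [← Finset.mul_sum, ← hsdef, inv_mul_cancel₀ hs.ne'])
  rw [h.eval_smul] at key
  exact (mul_eq_zero.1 key).resolve_left (pow_ne_zero _ (inv_ne_zero hs.ne'))

/-- A homogeneous polynomial in three of the variables which vanishes on the three coordinate
planes is divisible by the product of these variables. -/
theorem IsHomogeneous.exists_killOutside_eq_X_mul_X_mul_X [Fintype σ] {H : MvPolynomial σ ℝ} {m : ℕ}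
    (h : H.IsHomogeneous (m + 3)) {a b c : σ} (hab : a ≠ b) (hac : a ≠ c) (hbc : b ≠ c)
    (ha : MvPolynomial.killOutside {b, c} H = 0) (hb : MvPolynomial.killOutside {a, c} H = 0)
    (hc : MvPolynomial.killOutside {a, b} H = 0) :
    ∃ G, G.IsHomogeneous m ∧ MvPolynomial.killOutside {a, b, c} H = X a * (X b * (X c * G)) := by
  have hK := h.killOutside {a, b, c}
  set K := MvPolynomial.killOutside {a, b, c} H with hKdef
  have da : X a ∣ K := by
    apply X_dvd_of_killOutside_eq_zero
    rw [hKdef, killOutside_killOutside, ← ha]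
    congr 2
    ext x; simp; grind
  have db : X b ∣ K := by
    apply X_dvd_of_killOutside_eq_zero
    rw [hKdef, killOutside_killOutside, ← hb]
    congr 2
    ext x; simp; grind
  have dc : X c ∣ K := by
    apply X_dvd_of_killOutside_eq_zero
    rw [hKdef, killOutside_killOutside, ← hc]
    congr 2
    ext x; simp; grind
  obtain ⟨K1, hK1, e1⟩ := IsHomogeneous.exists_eq_X_mul (n := m + 2) hK da
  rw [e1] at db dc
  obtain ⟨K2, hK2, e2⟩ :=
    IsHomogeneous.exists_eq_X_mul (n := m + 1) hK1 (X_dvd_of_dvd_X_mul hab.symm db)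
  rw [e2] at dc
  obtain ⟨K3, hK3, e3⟩ := IsHomogeneous.exists_eq_X_mul hK2
    (X_dvd_of_dvd_X_mul hbc.symm (X_dvd_of_dvd_X_mul hac.symm dc))
  exact ⟨K3, hK3, by rw [e1, e2, e3]⟩

/-- The components, along the edges from the vertex `0`, of a polynomial covector field of degree
`m + 3` whose tangential traces on the faces of the tetrahedron vanish. -/
theorem exists_decomposition_of_tangential_trace_eq_zero {m : ℕ} {U₁ U₂ U₃ : MvPolynomial (Fin 4) ℝ}
    (h₁ : U₁.IsHomogeneous (m + 3)) (h₂ : U₂.IsHomogeneous (m + 3)) (h₃ : U₃.IsHomogeneous (m + 3))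
    (h₁₂ : X 2 ∣ U₁) (h₁₃ : X 3 ∣ U₁) (h₂₁ : X 1 ∣ U₂) (h₂₃ : X 3 ∣ U₂)
    (h₃₁ : X 1 ∣ U₃) (h₃₂ : X 2 ∣ U₃) (h₀₂ : X 0 ∣ U₁ - U₂) (h₀₃ : X 0 ∣ U₁ - U₃) :
    ∃ c d₁ d₂ d₃ : MvPolynomial (Fin 4) ℝ, c.IsHomogeneous m ∧ d₁.IsHomogeneous m ∧
      d₂.IsHomogeneous m ∧ d₃.IsHomogeneous m ∧ U₁ = X 2 * (X 3 * (X 1 * c + X 0 * d₁)) ∧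
      U₂ = X 1 * (X 3 * (X 2 * c + X 0 * d₂)) ∧ U₃ = X 1 * (X 2 * (X 3 * c + X 0 * d₃)) := by
  obtain ⟨A₁, hA₁, rfl⟩ := IsHomogeneous.exists_eq_X_mul_X_mul (m := m + 1) h₁ (by decide) h₁₂ h₁₃
  obtain ⟨A₂, hA₂, rfl⟩ := IsHomogeneous.exists_eq_X_mul_X_mul (m := m + 1) h₂ (by decide) h₂₁ h₂₃
  obtain ⟨A₃, hA₃, rfl⟩ := IsHomogeneous.exists_eq_X_mul_X_mul (m := m + 1) h₃ (by decide) h₃₁ h₃₂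
  set ρ := killOutside (Finset.univ.erase (0 : Fin 4)) with hρ
  have hρ0 : ρ (X 0) = 0 := by simp [hρ, killOutside_X]
  have hρ1 : ρ (X 1) = X 1 := by simp [hρ, killOutside_X]
  have hρ2 : ρ (X 2) = X 2 := by simp [hρ, killOutside_X]
  have hρ3 : ρ (X 3) = X 3 := by simp [hρ, killOutside_X]
  -- On the face λ_0 = 0 the traces of U₁ and U₂ agree; the common factor λ_3 cancels.
  have e₁₂ : X 2 * ρ A₁ = X 1 * ρ A₂ := by
    obtain ⟨w, hw⟩ := h₀₂
    have := congrArg ρ hw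
    simp only [map_sub, map_mul, hρ0, hρ1, hρ2, hρ3, zero_mul] at this
    refine mul_left_cancel₀ (X_ne_zero (R := ℝ) (3 : Fin 4)) ?_
    linear_combination this
  have e₁₃ : X 3 * ρ A₁ = X 1 * ρ A₃ := by
    obtain ⟨w, hw⟩ := h₀₃
    have := congrArg ρ hw
    simp only [map_sub, map_mul, hρ0, hρ1, hρ2, hρ3, zero_mul] at this
    refine mul_left_cancel₀ (X_ne_zero (R := ℝ) (2 : Fin 4)) ?_
    linear_combination this
  -- Since λ_1 is prime and does not divide λ_2, it divides the trace of A₁. The two relations then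
  -- give the traces of A₂ and A₃ with the same quotient c.
  obtain ⟨c, hc, ec⟩ := (hA₁.killOutside (Finset.univ.erase 0)).exists_eq_X_mul
    (X_dvd_of_dvd_X_mul (i := (1 : Fin 4)) (j := 2) (by decide) ⟨_, e₁₂⟩)
  rw [← hρ] at ec
  have ec₂ : ρ A₂ = X 2 * c := by
    refine mul_left_cancel₀ (X_ne_zero (R := ℝ) (1 : Fin 4)) ?_
    rw [← e₁₂, ec]; ring
  have ec₃ : ρ A₃ = X 3 * c := by
    refine mul_left_cancel₀ (X_ne_zero (R := ℝ) (1 : Fin 4)) ?_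
    rw [← e₁₃, ec]; ring
  -- The d_i measure how each A_i differs from its trace on λ_0 = 0.
  obtain ⟨d₁, hd₁, ed₁⟩ := (hA₁.sub (hA₁.killOutside (Finset.univ.erase 0))).exists_eq_X_mul
    (X_dvd_sub_killOutside 0 A₁)
  obtain ⟨d₂, hd₂, ed₂⟩ := (hA₂.sub (hA₂.killOutside (Finset.univ.erase 0))).exists_eq_X_mul
    (X_dvd_sub_killOutside 0 A₂)
  obtain ⟨d₃, hd₃, ed₃⟩ := (hA₃.sub (hA₃.killOutside (Finset.univ.erase 0))).exists_eq_X_mul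
    (X_dvd_sub_killOutside 0 A₃)
  rw [← hρ] at ed₁ ed₂ ed₃
  refine ⟨c, d₁, d₂, d₃, hc, hd₁, hd₂, hd₃, ?_, ?_, ?_⟩
  · rw [← ec, ← ed₁]; ring
  · rw [← ec₂, ← ed₂]; ring
  · rw [← ec₃, ← ed₃]; ring

end MvPolynomial

/-! ### Bounded degree, restriction and barycentric coordinates -/

open MvPolynomial in
theorem mem_polySpace_natCast {P : MvPolynomial (Fin 3) ℝ} {m : ℕ} :
    P ∈ polySpace (m : ℤ) ↔ P.totalDegree ≤ m := by
  rw [polySpace, mem_restrictSupport_iff, MvPolynomial.totalDegree, Finset.sup_le_iff]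
  refine forall_congr' fun d => ?_
  simp only [Finsupp.degree_apply, Finsupp.sum, Set.mem_ofPred_eq, Finset.mem_coe]
  norm_cast

theorem MvPolynomial.totalDegree_aeval_le {σ τ : Type*} {g : σ → MvPolynomial τ ℝ}
    (hg : ∀ i, (g i).totalDegree ≤ 1) (H : MvPolynomial σ ℝ) :
    (MvPolynomial.aeval g H).totalDegree ≤ H.totalDegree := by
  rw [MvPolynomial.aeval_def, MvPolynomial.eval₂_eq]
  refine MvPolynomial.totalDegree_finsetSum_le fun d hd => ?_
  rw [MvPolynomial.algebraMap_eq]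
  refine (MvPolynomial.totalDegree_mul _ _).trans ?_
  rw [MvPolynomial.totalDegree_C, zero_add]
  refine (MvPolynomial.totalDegree_finsetProd _ _).trans ?_
  refine le_trans (Finset.sum_le_sum fun i _ => ?_) (MvPolynomial.le_totalDegree hd)
  refine (MvPolynomial.totalDegree_pow _ _).trans ?_
  simpa using Nat.mul_le_mul_left (d i) (hg i)

theorem polySpace_of_neg {m : ℤ} (hm : m < 0) : polySpace m = ⊥ := by
  rw [polySpace, show {d : Fin 3 →₀ ℕ | ((Finsupp.degree d : ℕ) : ℤ) ≤ m} = ∅ by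
    ext d; simp; omega, MvPolynomial.restrictSupport_eq_span]
  simp

theorem restrictTo_apply (S : Set E3) (P : MvPolynomial (Fin 3) ℝ) (x : S) :
    restrictTo S P x = MvPolynomial.eval x.1.ofLp P := rfl

theorem continuous_eval_ofLp (P : MvPolynomial (Fin 3) ℝ) :
    Continuous fun x : E3 => MvPolynomial.eval x.ofLp P :=
  (MvPolynomial.continuous_eval P).comp (PiLp.continuous_ofLp 2 _)

theorem continuous_of_mem_polyOn {S : Set E3} {m : ℤ} {q : S → ℝ} (hq : q ∈ polyOn S m) :
    Continuous q := by
  obtain ⟨P, -, rfl⟩ := hq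
  exact (continuous_eval_ofLp P).comp continuous_subtype_val

theorem continuous_of_mem_vecPolyOn {S : Set E3} {m : ℤ} {q : S → E3} (hq : q ∈ vecPolyOn S m) :
    Continuous q :=
  (PiLp.continuous_toLp 2 _).comp (continuous_pi fun i => continuous_of_mem_polyOn (hq i))

namespace Affine.Simplex

variable (T : Affine.Simplex ℝ E3 3)

/-- The vertices of a tetrahedron as an affine basis of three-space. -/
noncomputable def tetBasis : AffineBasis (Fin 4) ℝ E3 :=
  ⟨T.points, T.independent, by
    rw [T.independent.affineSpan_eq_top_iff_card_eq_finrank_add_one]; simp⟩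

/-- The barycentric coordinates of a point with respect to the vertices of a tetrahedron. -/
noncomputable def bary (x : E3) (a : Fin 4) : ℝ := T.tetBasis.coord a x

theorem sum_bary (x : E3) : ∑ a, T.bary x a = 1 := T.tetBasis.sum_coord_apply_eq_one x

theorem sum_bary_smul (x : E3) : ∑ a, T.bary x a • T.points a = x :=
  T.tetBasis.linear_combination_coord_eq_self x

theorem bary_sum_smul {w : Fin 4 → ℝ} (hw : ∑ a, w a = 1) (a : Fin 4) :
    T.bary (∑ c, w c • T.points c) a = w a := by
  have := T.tetBasis.coord_apply_combination_of_mem (Finset.mem_univ a) hw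
  rwa [Finset.affineCombination_eq_linear_combination _ _ _ hw] at this

theorem mem_closedInterior_face_iff {S : Finset (Fin 4)} {m : ℕ} (h : S.card = m + 1) {x : E3} :
    x ∈ (T.face h).closedInterior ↔ (∀ a, 0 ≤ T.bary x a) ∧ ∀ a ∉ S, T.bary x a = 0 := by
  have hx := T.tetBasis.affineCombination_coord_eq_self x
  have := T.affineCombination_mem_closedInterior_face_iff_nonneg h
    (w := T.bary x) (T.sum_bary x)
  rw [show Finset.univ.affineCombination ℝ T.points (T.bary x) = x from hx] at this
  rw [this]
  refine ⟨fun h => ⟨fun a => ?_, h.2⟩, fun h => ⟨fun a _ => h.1 a, h.2⟩⟩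
  by_cases ha : a ∈ S
  · exact h.1 a ha
  · exact (h.2 a ha).ge

theorem mem_closedInterior_iff {x : E3} :
    x ∈ T.closedInterior ↔ ∀ a, 0 ≤ T.bary x a := by
  have hx := T.tetBasis.affineCombination_coord_eq_self x
  have := T.affineCombination_mem_closedInterior_iff (w := T.bary x) (T.sum_bary x)
  rw [show Finset.univ.affineCombination ℝ T.points (T.bary x) = x from hx] at this
  rw [this]
  refine ⟨fun h a => (h a).1, fun h a => ⟨h a, ?_⟩⟩
  rw [← T.sum_bary x]
  exact Finset.single_le_sum (fun c _ => h c) (Finset.mem_univ a)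

/-- The barycentric coordinates as polynomials. -/
noncomputable def baryPoly (a : Fin 4) : MvPolynomial (Fin 3) ℝ :=
  MvPolynomial.C (T.bary 0 a) + ∑ j, MvPolynomial.C (T.bary (EuclideanSpace.single j 1) a
    - T.bary 0 a) * MvPolynomial.X j

theorem eval_baryPoly (a : Fin 4) (x : E3) :
    MvPolynomial.eval x.ofLp (T.baryPoly a) = T.bary x a := by
  have h : ∀ y, T.bary y a = (T.tetBasis.coord a).linear y + T.bary 0 a := fun y => by
    have := (T.tetBasis.coord a).map_vadd 0 y
    rwa [vadd_eq_add, vadd_eq_add, add_zero] at this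
  have hx : x = ∑ j, x.ofLp j • EuclideanSpace.single j (1 : ℝ) := by
    ext i
    simp [Fin.sum_univ_three]
    fin_cases i <;> simp
  rw [baryPoly]
  conv_rhs => rw [h, hx, map_sum]
  simp only [map_add, MvPolynomial.eval_C, map_sum, map_mul, MvPolynomial.eval_X, map_smul,
    smul_eq_mul]
  simp_rw [h (EuclideanSpace.single _ _)]
  simp [Fin.sum_univ_three]
  ring

theorem totalDegree_baryPoly_le (a : Fin 4) : (T.baryPoly a).totalDegree ≤ 1 := by
  refine (MvPolynomial.totalDegree_add _ _).trans (max_le (by simp) ?_)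
  refine MvPolynomial.totalDegree_finsetSum_le fun j _ => ?_
  refine (MvPolynomial.totalDegree_mul _ _).trans ?_
  rw [MvPolynomial.totalDegree_C, MvPolynomial.totalDegree_X]

/-- Substitution of the barycentric coordinates for the four variables. -/
noncomputable def baryMap : MvPolynomial (Fin 4) ℝ →ₐ[ℝ] MvPolynomial (Fin 3) ℝ :=
  MvPolynomial.aeval T.baryPoly

theorem eval_baryMap (H : MvPolynomial (Fin 4) ℝ) (x : E3) :
    MvPolynomial.eval x.ofLp (T.baryMap H) = MvPolynomial.eval (T.bary x) H := by
  have : ((MvPolynomial.aeval x.ofLp : MvPolynomial (Fin 3) ℝ →ₐ[ℝ] ℝ).comp T.baryMap) =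
      MvPolynomial.aeval (T.bary x) := by
    ext a
    simpa [baryMap, MvPolynomial.aeval_eq_eval] using T.eval_baryPoly a x
  have h2 := congrArg (fun f : MvPolynomial (Fin 4) ℝ →ₐ[ℝ] ℝ => f H) this
  simpa [MvPolynomial.aeval_eq_eval] using h2

theorem baryMap_mem_polySpace {H : MvPolynomial (Fin 4) ℝ} {m : ℕ} (hH : H.IsHomogeneous m) :
    T.baryMap H ∈ polySpace (m : ℤ) :=
  mem_polySpace_natCast.2 ((MvPolynomial.totalDegree_aeval_le T.totalDegree_baryPoly_le H).trans
    hH.totalDegree_le)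

theorem eq_of_eval_ofLp_eq {P Q : MvPolynomial (Fin 3) ℝ}
    (h : ∀ x : E3, MvPolynomial.eval x.ofLp P = MvPolynomial.eval x.ofLp Q) : P = Q :=
  MvPolynomial.funext fun x => h (WithLp.toLp 2 x)

/-- Every polynomial of degree at most `m` in space is a homogeneous polynomial of degree `m` in
the barycentric coordinates. -/
theorem exists_isHomogeneous_baryMap_eq {P : MvPolynomial (Fin 3) ℝ} {m : ℕ}
    (hP : P ∈ polySpace (m : ℤ)) : ∃ H, H.IsHomogeneous m ∧ T.baryMap H = P := by
  suffices polySpace (m : ℤ) ≤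
      (MvPolynomial.homogeneousSubmodule (Fin 4) ℝ m).map T.baryMap.toLinearMap from this hP
  rw [polySpace, MvPolynomial.restrictSupport_eq_span, Submodule.span_le]
  rintro _ ⟨d, hd, rfl⟩
  have hd' : Finsupp.degree d ≤ m := by exact_mod_cast hd
  let Y : Fin 3 → MvPolynomial (Fin 4) ℝ := fun i =>
    ∑ a, MvPolynomial.C (T.points a i) * MvPolynomial.X a
  let s : MvPolynomial (Fin 4) ℝ := ∑ a, MvPolynomial.X a
  have hY : ∀ i, (Y i).IsHomogeneous 1 := fun i =>
    MvPolynomial.IsHomogeneous.sum _ _ _ fun a _ => MvPolynomial.isHomogeneous_C_mul_X _ _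
  have hs : s.IsHomogeneous 1 :=
    MvPolynomial.IsHomogeneous.sum _ _ _ fun a _ => MvPolynomial.isHomogeneous_X _ _
  have eY : ∀ i, T.baryMap (Y i) = MvPolynomial.X i := fun i => by
    refine eq_of_eval_ofLp_eq fun x => ?_
    rw [eval_baryMap]
    have := congrArg (fun y : E3 => y i) (T.sum_bary_smul x)
    simpa [Y, mul_comm] using this
  have es : T.baryMap s = 1 := by
    refine eq_of_eval_ofLp_eq fun x => ?_
    rw [eval_baryMap]
    simpa [s] using T.sum_bary x
  -- Multiplying by powers of s = Σ λ_a raises the degree to exactly m without changing the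
  -- function, because s takes the value 1.
  refine ⟨(∏ i, Y i ^ d i) * s ^ (m - Finsupp.degree d), ?_, ?_⟩
  · have h1 := (MvPolynomial.IsHomogeneous.prod Finset.univ (fun i => Y i ^ d i) (fun i => 1 * d i)
      (fun i _ => (hY i).pow _)).mul (hs.pow (m - Finsupp.degree d))
    have h2 : ∑ i, 1 * d i + 1 * (m - Finsupp.degree d) = m := by
      rw [Finsupp.degree_eq_sum] at *
      simp only [one_mul]; omega
    rwa [h2] at h1
  · simp only [AlgHom.toLinearMap_apply, map_mul, map_prod, map_pow, eY, es, one_pow, mul_one]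
    rw [MvPolynomial.monomial_eq, Finsupp.prod_fintype _ _ (by simp)]
    simp

theorem eval_eq_zero_of_killOutside_eq_zero {H : MvPolynomial (Fin 4) ℝ} {S : Finset (Fin 4)}
    (h : MvPolynomial.killOutside S H = 0) {x : E3} (hx : ∀ a ∉ S, T.bary x a = 0) :
    MvPolynomial.eval (T.bary x) H = 0 := by
  rw [← MvPolynomial.eval_killOutside_of_support hx, h, map_zero]

theorem killOutside_eq_zero_of_eval {H : MvPolynomial (Fin 4) ℝ} {m : ℕ} (hH : H.IsHomogeneous m)
    {S : Finset (Fin 4)} (hS : S.Nonempty)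
    (h : ∀ x : E3, (∀ a, 0 ≤ T.bary x a) → (∀ a ∉ S, T.bary x a = 0) →
      MvPolynomial.eval (T.bary x) H = 0) :
    MvPolynomial.killOutside S H = 0 := by
  refine hH.killOutside_eq_zero hS fun μ h0 hμ h1 => ?_
  have e : T.bary (∑ c, μ c • T.points c) = μ := funext fun a => T.bary_sum_smul h1 a
  have := h (∑ c, μ c • T.points c)
  rw [e] at this
  exact this h0 hμ

end Affine.Simplex

/-! ### Edges: Hermite data and edge moments -/

theorem MvPolynomial.natDegree_aeval_le {σ : Type*} {g : σ → Polynomial ℝ}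
    (hg : ∀ i, (g i).natDegree ≤ 1) (P : MvPolynomial σ ℝ) :
    (MvPolynomial.aeval g P).natDegree ≤ P.totalDegree := by
  rw [MvPolynomial.aeval_def, MvPolynomial.eval₂_eq]
  refine Polynomial.natDegree_sum_le_of_forall_le _ _ fun d hd => ?_
  rw [Polynomial.algebraMap_eq]
  refine (Polynomial.natDegree_C_mul_le _ _).trans ?_
  refine (Polynomial.natDegree_prod_le _ _).trans ?_
  refine le_trans (Finset.sum_le_sum fun i _ => ?_) (MvPolynomial.le_totalDegree hd)
  refine Polynomial.natDegree_pow_le.trans ?_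
  simpa using Nat.mul_le_mul_left (d i) (hg i)

/-- The chain rule along a polynomial curve: it converts zero gradients at the vertices into zero
derivatives at the ends of an edge. -/
theorem MvPolynomial.derivative_aeval {σ : Type*} [Fintype σ] (g : σ → Polynomial ℝ)
    (P : MvPolynomial σ ℝ) :
    Polynomial.derivative (MvPolynomial.aeval g P) =
      ∑ j, MvPolynomial.aeval g (MvPolynomial.pderiv j P) * Polynomial.derivative (g j) := by
  classical
  induction P using MvPolynomial.induction_on with
  | C a => simp [MvPolynomial.algHom_C]
  | add p q hp hq => simp [hp, hq, add_mul, Finset.sum_add_distrib]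
  | mul_X p i hp =>
    have key : ∀ j, MvPolynomial.aeval g (MvPolynomial.pderiv j (p * MvPolynomial.X i)) *
        Polynomial.derivative (g j) = MvPolynomial.aeval g (MvPolynomial.pderiv j p) *
        Polynomial.derivative (g j) * g i +
        if i = j then MvPolynomial.aeval g p * Polynomial.derivative (g i) else 0 := by
      intro j
      rw [MvPolynomial.pderiv_mul]
      rcases eq_or_ne i j with rfl | h
      · rw [MvPolynomial.pderiv_X_self, mul_one, map_add, map_mul, MvPolynomial.aeval_X, if_pos rfl]
        ring
      · rw [MvPolynomial.pderiv_X_of_ne h, mul_zero, add_zero, map_mul, MvPolynomial.aeval_X,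
          if_neg h]
        ring
    rw [Finset.sum_congr rfl fun j _ => key j, Finset.sum_add_distrib, ← Finset.sum_mul, ← hp,
      Finset.sum_ite_eq, if_pos (Finset.mem_univ i), map_mul, MvPolynomial.aeval_X]
    exact Polynomial.derivative_mul

theorem Polynomial.totalDegree_aeval_le {σ : Type*} {g : MvPolynomial σ ℝ}
    (hg : g.totalDegree ≤ 1) (P : Polynomial ℝ) :
    (Polynomial.aeval g P).totalDegree ≤ P.natDegree := by
  rw [Polynomial.aeval_eq_sum_range]
  refine MvPolynomial.totalDegree_finsetSum_le fun i hi => ?_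
  refine (MvPolynomial.totalDegree_smul_le _ _).trans ((MvPolynomial.totalDegree_pow _ _).trans ?_)
  have := Finset.mem_range.1 hi
  calc i * g.totalDegree ≤ i * 1 := Nat.mul_le_mul_left i hg
    _ ≤ P.natDegree := by omega

theorem Polynomial.exists_eq_mul_of_double_roots {h : Polynomial ℝ} (h0 : h.eval 0 = 0)
    (h1 : h.eval 1 = 0) (d0 : h.derivative.eval 0 = 0) (d1 : h.derivative.eval 1 = 0) :
    ∃ g, h = ((X - C 0) ^ 2 * (X - C 1) ^ 2) * g := by
  have key : ∀ t, h.eval t = 0 → h.derivative.eval t = 0 → (X - C t) ^ 2 ∣ h := by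
    intro t ht dt
    by_cases hh : h = 0
    · simp [hh]
    · exact (Polynomial.le_rootMultiplicity_iff hh).1
        ((Polynomial.one_lt_rootMultiplicity_iff_isRoot hh).2 ⟨ht, dt⟩)
  exact (IsCoprime.pow (Polynomial.isCoprime_X_sub_C_of_isUnit_sub (by simp))).mul_dvd
    (key 0 h0 d0) (key 1 h1 d1)

namespace Affine.Simplex

variable (T : Affine.Simplex ℝ E3 3)

/-- A polynomial with vanishing vertex values, vertex gradients and edge moments vanishes on the
edges. -/
theorem eval_eq_zero_on_edge {p : ℕ} {P : MvPolynomial (Fin 3) ℝ} (hP : P.totalDegree ≤ p)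
    (hv : ∀ a, MvPolynomial.eval (T.points a).ofLp P = 0)
    (hd : ∀ a j, MvPolynomial.eval (T.points a).ofLp (MvPolynomial.pderiv j P) = 0)
    (e : TetEdge)
    (hm : ∀ q ∈ polyOn (tetEdge T e).closedInterior ((p : ℤ) - 4),
      ∫ x, MvPolynomial.eval x.1.ofLp P * q x ∂(simplexMeasure (tetEdge T e)) = 0)
    (x : E3) (hx : x ∈ (tetEdge T e).closedInterior) : MvPolynomial.eval x.ofLp P = 0 := by
  obtain ⟨S, hS⟩ := e
  obtain ⟨a, b, hab, rfl⟩ := Finset.card_eq_two.1 hS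
  let ℓ : Fin 3 → Polynomial ℝ := fun j =>
    Polynomial.C (T.points a j) + Polynomial.C (T.points b j - T.points a j) * Polynomial.X
  set h : Polynomial ℝ := MvPolynomial.aeval ℓ P with hh
  have hev : ∀ (Q : MvPolynomial (Fin 3) ℝ) (t : ℝ), (MvPolynomial.aeval ℓ Q).eval t =
      MvPolynomial.eval (fun j => T.points a j + (T.points b j - T.points a j) * t) Q := by
    intro Q t
    have : ((Polynomial.aeval t : Polynomial ℝ →ₐ[ℝ] ℝ).comp (MvPolynomial.aeval ℓ)) =
        MvPolynomial.aeval (fun j => T.points a j + (T.points b j - T.points a j) * t) := by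
      ext j
      simp [ℓ]
    have h2 := congrArg (fun f : MvPolynomial (Fin 3) ℝ →ₐ[ℝ] ℝ => f Q) this
    simpa [MvPolynomial.aeval_eq_eval, Polynomial.aeval_def, Polynomial.eval₂_eq_eval_map] using h2
  have hev0 : ∀ Q : MvPolynomial (Fin 3) ℝ, (MvPolynomial.aeval ℓ Q).eval 0 =
      MvPolynomial.eval (T.points a).ofLp Q := fun Q => by rw [hev]; simp
  have hev1 : ∀ Q : MvPolynomial (Fin 3) ℝ, (MvPolynomial.aeval ℓ Q).eval 1 =
      MvPolynomial.eval (T.points b).ofLp Q := fun Q => by rw [hev]; simp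
  have hdeg : h.natDegree ≤ p := by
    refine (MvPolynomial.natDegree_aeval_le (fun j => ?_) P).trans hP
    simpa [ℓ, add_comm] using Polynomial.natDegree_linear_le
      (a := T.points b j - T.points a j) (b := T.points a j)
  obtain ⟨g, hg⟩ := Polynomial.exists_eq_mul_of_double_roots (h := h)
    (by rw [hh, hev0, hv]) (by rw [hh, hev1, hv])
    (by rw [hh, MvPolynomial.derivative_aeval, Polynomial.eval_finsetSum]
        exact Finset.sum_eq_zero fun j _ => by rw [Polynomial.eval_mul, hev0, hd, zero_mul])
    (by rw [hh, MvPolynomial.derivative_aeval, Polynomial.eval_finsetSum]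
        exact Finset.sum_eq_zero fun j _ => by rw [Polynomial.eval_mul, hev1, hd, zero_mul])
  have hline : ∀ y ∈ (tetEdge T ⟨{a, b}, hS⟩).closedInterior,
      MvPolynomial.eval y.ofLp P = h.eval (T.bary y b) := by
    intro y hy
    have hy' := ((T.mem_closedInterior_face_iff hS).1 hy).2
    have hs := T.sum_bary y
    have hp := T.sum_bary_smul y
    rw [← Finset.sum_subset (Finset.subset_univ {a, b}) (fun c _ hc => hy' c hc),
      Finset.sum_pair hab] at hs
    rw [← Finset.sum_subset (Finset.subset_univ {a, b}) (fun c _ hc => by rw [hy' c hc, zero_smul]),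
      Finset.sum_pair hab] at hp
    rw [hh, hev]
    congr 2
    funext j
    have hj := congrArg (fun z : E3 => z j) hp
    simp only [PiLp.add_apply, PiLp.smul_apply, smul_eq_mul] at hj
    rw [← hj]
    linear_combination (T.points a j) * hs
  have hheval : ∀ t, h.eval t = t ^ 2 * (t - 1) ^ 2 * g.eval t := fun t => by
    rw [hg]; simp
  rw [hline x hx, hheval]
  by_cases hg0 : g = 0
  · simp [hg0]
  -- A nonzero g forces p ≥ 4, so the case p = 3, with no edge test functions, is already settled.
  have hnd : (g.natDegree : ℤ) + 4 ≤ p := by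
    have h1 : h.natDegree = 4 + g.natDegree := by
      rw [hg, Polynomial.natDegree_mul (mul_ne_zero (pow_ne_zero _ (Polynomial.X_sub_C_ne_zero _))
        (pow_ne_zero _ (Polynomial.X_sub_C_ne_zero _))) hg0,
        Polynomial.natDegree_mul (pow_ne_zero _ (Polynomial.X_sub_C_ne_zero _))
        (pow_ne_zero _ (Polynomial.X_sub_C_ne_zero _)), Polynomial.natDegree_pow,
        Polynomial.natDegree_pow, Polynomial.natDegree_X_sub_C, Polynomial.natDegree_X_sub_C]
    omega
  -- An extension of g from the edge to space: λ_b is the edge parameter t. Tested against it, the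
  -- integrand is t²(t-1)²g(t)².
  let Q : MvPolynomial (Fin 3) ℝ := Polynomial.aeval (T.baryPoly b) g
  have hQe : ∀ y : E3, MvPolynomial.eval y.ofLp Q = g.eval (T.bary y b) := fun y => by
    have : ((MvPolynomial.aeval y.ofLp : MvPolynomial (Fin 3) ℝ →ₐ[ℝ] ℝ).comp
        (Polynomial.aeval (T.baryPoly b))) = Polynomial.aeval (T.bary y b) := by
      ext
      simpa [MvPolynomial.aeval_eq_eval] using T.eval_baryPoly b y
    have h2 := congrArg (fun f : Polynomial ℝ →ₐ[ℝ] ℝ => f g) this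
    simpa [MvPolynomial.aeval_eq_eval, Polynomial.coe_aeval_eq_eval] using h2
  have hQ : Q ∈ polySpace ((p : ℤ) - 4) := by
    have h1 : ((p : ℤ) - 4) = ((p - 4 : ℕ) : ℤ) := by omega
    rw [h1, mem_polySpace_natCast]
    refine (Polynomial.totalDegree_aeval_le (T.totalDegree_baryPoly_le b) g).trans (by omega)
  have hz := eq_zero_of_integral_simplexMeasure_eq_zero (tetEdge T ⟨{a, b}, hS⟩)
    (g := fun y => MvPolynomial.eval y.1.ofLp P * restrictTo _ Q y)
    (((continuous_eval_ofLp P).mul (continuous_eval_ofLp Q)).comp continuous_subtype_val)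
    (fun y => by
      rw [restrictTo_apply, hline y.1 y.2, hQe, hheval]
      nlinarith [mul_self_nonneg (T.bary y.1 b * (T.bary y.1 b - 1) * g.eval (T.bary y.1 b))])
    (hm _ ⟨Q, hQ, rfl⟩) ⟨x, hx⟩
  simp only [restrictTo_apply] at hz
  rw [hline x hx, hQe, hheval] at hz
  rcases mul_eq_zero.1 hz with h' | h'
  · exact h'
  · rw [h', mul_zero]

end Affine.Simplex

/-! ### Faces: cross products and tangential traces -/

theorem inner_E3 (u v : E3) : inner ℝ u v = u 0 * v 0 + u 1 * v 1 + u 2 * v 2 := by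
  simp [PiLp.inner_apply, Fin.sum_univ_three]
  ring

theorem cross_apply_zero (u v : E3) : cross u v 0 = u 1 * v 2 - u 2 * v 1 := by
  simp [cross, crossProduct]

theorem cross_apply_one (u v : E3) : cross u v 1 = u 2 * v 0 - u 0 * v 2 := by
  simp [cross, crossProduct]

theorem cross_apply_two (u v : E3) : cross u v 2 = u 0 * v 1 - u 1 * v 0 := by
  simp [cross, crossProduct]

theorem cross_smul_left (c : ℝ) (u v : E3) : cross (c • u) v = c • cross u v := by
  simp [cross]

theorem inner_cross_right_self (u n : E3) : inner ℝ n (cross u n) = 0 := by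
  rw [inner_E3, cross_apply_zero, cross_apply_one, cross_apply_two]
  ring

theorem continuous_cross_left (n : E3) : Continuous fun u : E3 => cross u n := by
  refine (PiLp.continuous_toLp 2 _).comp (continuous_pi fun i => ?_)
  fin_cases i <;> simp [crossProduct] <;> fun_prop

/-- A vector with vanishing cross product with a unit vector `n` is orthogonal to the plane normal
to `n`. -/
theorem inner_eq_zero_of_cross_eq_zero {u n w : E3} (hn : ‖n‖ = 1) (hw : inner ℝ n w = 0)
    (h : cross u n = 0) : inner ℝ u w = 0 := by
  have hn' : inner ℝ n n = (1 : ℝ) := by rw [real_inner_self_eq_norm_sq, hn]; norm_num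
  have h0 : cross u n 0 = 0 := by rw [h]; rfl
  have h1 : cross u n 1 = 0 := by rw [h]; rfl
  have h2 : cross u n 2 = 0 := by rw [h]; rfl
  rw [cross_apply_zero] at h0
  rw [cross_apply_one] at h1
  rw [cross_apply_two] at h2
  rw [inner_E3] at hn' hw ⊢
  -- This is Lagrange's identity (u × n) · (w × n) = (u · w)(n · n) - (u · n)(w · n).
  linear_combination (-(u 0 * w 0 + u 1 * w 1 + u 2 * w 2)) * hn' +
    (u 0 * n 0 + u 1 * n 1 + u 2 * n 2) * hw + (w 1 * n 2 - w 2 * n 1) * h0 +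
    (w 2 * n 0 - w 0 * n 2) * h1 + (w 0 * n 1 - w 1 * n 0) * h2

/-- The plane of the triangle lies in the orthogonal complement of n, and both have dimension two.
-/
theorem IsUnitNormal.mem_direction {F : Affine.Simplex ℝ E3 2} {n : E3} (hn : IsUnitNormal F n)
    {w : E3} (hw : inner ℝ n w = 0) : w ∈ (affineSpan ℝ (Set.range F.points)).direction := by
  have hn0 : n ≠ 0 := fun h => by simpa [h] using hn.1
  have hle : (affineSpan ℝ (Set.range F.points)).direction ≤ (ℝ ∙ n)ᗮ := fun v hv =>
    (Submodule.mem_orthogonal_singleton_iff_inner_right).2 (hn.2 v hv)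
  have hfin : Module.finrank ℝ (affineSpan ℝ (Set.range F.points)).direction = 2 := by
    rw [direction_affineSpan]
    exact F.independent.finrank_vectorSpan (by simp)
  have : Fact (Module.finrank ℝ E3 = 2 + 1) := ⟨by simp⟩
  have := Submodule.eq_of_le_of_finrank_eq hle
    (by rw [hfin, Submodule.finrank_orthogonal_span_singleton (n := 2) hn0])
  rw [this]
  exact (Submodule.mem_orthogonal_singleton_iff_inner_right).2 hw

theorem cross_mem_vecPolyOn {S : Set E3} {m : ℤ} {q : S → E3} (hq : q ∈ vecPolyOn S m) (n : E3) :
    (fun x => cross (q x) n) ∈ vecPolyOn S m := by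
  have key : ∀ (r s : ℝ) (i j : Fin 3), (fun x => q x i * r - q x j * s) ∈ polyOn S m := by
    intro r s i j
    have := Submodule.sub_mem _ (Submodule.smul_mem _ r (hq i)) (Submodule.smul_mem _ s (hq j))
    convert this using 1
    funext x
    simp [mul_comm]
  intro i
  fin_cases i
  · simpa only [Fin.zero_eta, cross_apply_zero] using key (n 2) (n 1) 1 2
  · simpa only [Fin.mk_one, cross_apply_one] using key (n 0) (n 2) 2 0
  · simpa only [Fin.reduceFinMk, cross_apply_two] using key (n 1) (n 0) 0 1

theorem VecPoly.continuous_at {p : ℕ} (E : VecPoly p) : Continuous E.at :=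
  (PiLp.continuous_toLp 2 _).comp (continuous_pi fun i => continuous_eval_ofLp (E i).1)

namespace Affine.Simplex

variable (T : Affine.Simplex ℝ E3 3)

theorem baryMap_mem_polySpace_of_eq {H : MvPolynomial (Fin 4) ℝ} {m : ℕ} (hH : H.IsHomogeneous m)
    {k : ℤ} (hk : k = m) : T.baryMap H ∈ polySpace k :=
  hk ▸ T.baryMap_mem_polySpace hH

theorem eval_bary_mem_polyOn (S : Set E3) {H : MvPolynomial (Fin 4) ℝ} {m : ℕ}
    (hH : H.IsHomogeneous m) {k : ℤ} (hk : k = m) :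
    (fun x : S => MvPolynomial.eval (T.bary x.1) H) ∈ polyOn S k :=
  ⟨_, T.baryMap_mem_polySpace_of_eq hH hk, by
    funext x; rw [restrictTo_apply, eval_baryMap]⟩

/-- The covector field whose components are homogeneous polynomials in the barycentric
coordinates. -/
noncomputable def baryField (G : Fin 3 → MvPolynomial (Fin 4) ℝ) (x : E3) : E3 :=
  WithLp.toLp 2 fun i => MvPolynomial.eval (T.bary x) (G i)

@[simp]
theorem baryField_apply (G : Fin 3 → MvPolynomial (Fin 4) ℝ) (x : E3) (i : Fin 3) :
    T.baryField G x i = MvPolynomial.eval (T.bary x) (G i) := rfl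

theorem baryField_mem_vecPolyOn (S : Set E3) {G : Fin 3 → MvPolynomial (Fin 4) ℝ} {m : ℕ}
    (hG : ∀ i, (G i).IsHomogeneous m) {k : ℤ} (hk : k = m) :
    (fun x : S => T.baryField G x) ∈ vecPolyOn S k :=
  fun i => T.eval_bary_mem_polyOn S (hG i) hk

theorem continuous_eval_bary (H : MvPolynomial (Fin 4) ℝ) :
    Continuous fun x : E3 => MvPolynomial.eval (T.bary x) H := by
  simp_rw [← eval_baryMap]
  exact continuous_eval_ofLp _

theorem continuous_baryField (G : Fin 3 → MvPolynomial (Fin 4) ℝ) : Continuous (T.baryField G) :=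
  (PiLp.continuous_toLp 2 _).comp (continuous_pi fun i => T.continuous_eval_bary (G i))

/-- If a vector polynomial vanishes on the edges and its moments on a face vanish, then its
tangential trace on this face vanishes. -/
theorem cross_eq_zero_on_face {m : ℕ} {E : VecPoly (m + 3)} {H : Fin 3 → MvPolynomial (Fin 4) ℝ}
    (hH : ∀ i, (H i).IsHomogeneous (m + 3)) (hE : ∀ x, E.at x = T.baryField H x)
    (hedge : ∀ S : Finset (Fin 4), S.card = 2 → ∀ i, MvPolynomial.killOutside S (H i) = 0)
    (f : TetFace) {n : E3} (hn : IsUnitNormal (tetFace T f) n)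
    (hf : ∀ q ∈ tangentPolyOn (tetFace T f) (((m + 3 : ℕ) : ℤ) - 3), faceMoment T E f n q = 0)
    (x : E3) (hx : x ∈ (tetFace T f).closedInterior) : cross (E.at x) n = 0 := by
  obtain ⟨S, hS⟩ := f
  obtain ⟨a, b, c, hab, hac, hbc, rfl⟩ := Finset.card_eq_three.1 hS
  choose G hG hGe using fun i => (hH i).exists_killOutside_eq_X_mul_X_mul_X hab hac hbc
    (hedge _ (Finset.card_pair hbc) i) (hedge _ (Finset.card_pair hac) i)
    (hedge _ (Finset.card_pair hab) i)
  have hEG : ∀ y ∈ (tetFace T ⟨{a, b, c}, hS⟩).closedInterior,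
      E.at y = (T.bary y a * T.bary y b * T.bary y c) • T.baryField G y := by
    intro y hy
    ext i
    rw [hE, PiLp.smul_apply, baryField_apply, baryField_apply,
      ← MvPolynomial.eval_killOutside_of_support ((T.mem_closedInterior_face_iff hS).1 hy).2, hGe]
    simp only [map_mul, MvPolynomial.eval_X, smul_eq_mul]
    ring
  have hk : (((m + 3 : ℕ) : ℤ) - 3) = m := by push_cast; ring
  -- The bubble λ_a λ_b λ_c lowers the degree by three, which is exactly the degree of the face test
  -- fields; a product with n is automatically tangential.
  let q : (tetFace T ⟨{a, b, c}, hS⟩).closedInterior → E3 := fun y => cross (T.baryField G y.1) n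
  have hq : q ∈ tangentPolyOn (tetFace T ⟨{a, b, c}, hS⟩) (((m + 3 : ℕ) : ℤ) - 3) := by
    exact ⟨cross_mem_vecPolyOn (T.baryField_mem_vecPolyOn _ hG hk) n,
      fun y => hn.mem_direction (inner_cross_right_self _ _)⟩
  have hEc : Continuous fun y : E3 => inner ℝ (cross (E.at y) n) (cross (T.baryField G y) n) :=
    ((continuous_cross_left n).comp E.continuous_at).inner
      ((continuous_cross_left n).comp (T.continuous_baryField G))
  have hval : ∀ y ∈ (tetFace T ⟨{a, b, c}, hS⟩).closedInterior,
      inner ℝ (cross (E.at y) n) (cross (T.baryField G y) n) =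
        (T.bary y a * T.bary y b * T.bary y c) * ‖cross (T.baryField G y) n‖ ^ 2 := by
    intro y hy
    rw [hEG y hy, cross_smul_left, real_inner_smul_left, real_inner_self_eq_norm_sq]
  have hz := eq_zero_of_integral_simplexMeasure_eq_zero (tetFace T ⟨{a, b, c}, hS⟩)
    (g := fun y => inner ℝ (cross (E.at y.1) n) (q y)) (hEc.comp continuous_subtype_val)
    (fun y => by
      have hy := ((T.mem_closedInterior_face_iff hS).1 y.2).1
      rw [hval y.1 y.2]
      exact mul_nonneg (mul_nonneg (mul_nonneg (hy a) (hy b)) (hy c)) (sq_nonneg _))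
    (hf q hq) ⟨x, hx⟩
  have hz' := (hval x hx).symm.trans hz
  rw [hEG x hx, cross_smul_left]
  rcases mul_eq_zero.1 hz' with h | h
  · rw [h, zero_smul]
  · rw [norm_eq_zero.1 (pow_eq_zero_iff two_ne_zero |>.1 h), smul_zero]

end Affine.Simplex

/-! ### Interior moments and injectivity -/

theorem VecPoly.continuous_at_comp {p : ℕ} (E : VecPoly p) (S : Set E3) :
    Continuous fun x : S => E.at x.1 := E.continuous_at.comp continuous_subtype_val

theorem continuous_of_mem_trimmedTwoForms {S : Set E3} {r : ℤ} {v : S → E3}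
    (hv : v ∈ trimmedTwoForms S r) : Continuous v := by
  obtain ⟨a, ha, _, ⟨b, hb, rfl⟩, rfl⟩ := Submodule.mem_sup.1 hv
  exact (continuous_of_mem_vecPolyOn ha).add
    ((continuous_of_mem_polyOn hb).smul continuous_subtype_val)

namespace Affine.Simplex

variable (T : Affine.Simplex ℝ E3 3)

theorem sub_points_zero_eq (x : E3) :
    x - T.points 0 = T.bary x 1 • (T.points 1 - T.points 0) + T.bary x 2 • (T.points 2 - T.points 0)
      + T.bary x 3 • (T.points 3 - T.points 0) := by
  have hs := T.sum_bary x
  have hp := T.sum_bary_smul x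
  rw [Fin.sum_univ_four] at hs hp
  conv_lhs => rw [← hp]
  rw [show T.bary x 0 = 1 - T.bary x 1 - T.bary x 2 - T.bary x 3 by linarith]
  module

/-- The three edge vectors at the vertex 0 span space, so u itself is a combination of them and is
orthogonal to itself. -/
theorem eq_zero_of_inner_sub_points_eq_zero {u : E3}
    (h1 : inner ℝ u (T.points 1 - T.points 0) = 0) (h2 : inner ℝ u (T.points 2 - T.points 0) = 0)
    (h3 : inner ℝ u (T.points 3 - T.points 0) = 0) : u = 0 := by
  have h := T.sub_points_zero_eq (u + T.points 0)
  rw [add_sub_cancel_right] at h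
  have : inner ℝ u u = (0 : ℝ) := by
    have h' := congrArg (inner ℝ u) h
    simpa only [inner_add_right, real_inner_smul_right, h1, h2, h3, mul_zero, add_zero] using h'
  exact inner_self_eq_zero.1 this

/-- The component along the edge from the vertex `b` to the vertex `a` of a covector field given in
barycentric coordinates. -/
noncomputable def edgeComponent (H : Fin 3 → MvPolynomial (Fin 4) ℝ) (a b : Fin 4) :
    MvPolynomial (Fin 4) ℝ :=
  ∑ i, MvPolynomial.C (T.points a i - T.points b i) * H i

theorem edgeComponent_isHomogeneous {H : Fin 3 → MvPolynomial (Fin 4) ℝ} {p : ℕ}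
    (hH : ∀ i, (H i).IsHomogeneous p) (a b : Fin 4) : (T.edgeComponent H a b).IsHomogeneous p :=
  MvPolynomial.IsHomogeneous.sum _ _ _ fun i _ => (hH i).C_mul _

theorem eval_edgeComponent (H : Fin 3 → MvPolynomial (Fin 4) ℝ) (a b : Fin 4) (x : E3) :
    MvPolynomial.eval (T.bary x) (T.edgeComponent H a b) =
      inner ℝ (T.baryField H x) (T.points a - T.points b) := by
  rw [inner_E3, edgeComponent, Fin.sum_univ_three]
  simp only [map_add, map_mul, MvPolynomial.eval_C, baryField_apply, PiLp.sub_apply]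
  ring

/-- A vector polynomial with vanishing tangential traces and interior moments vanishes on the
tetrahedron: tested against the field `v` below, it gives a sum of
squares with weights that are products of barycentric coordinates. -/
theorem eq_zero_of_interiorMoment_eq_zero {m : ℕ} {E : VecPoly (m + 3)}
    {H : Fin 3 → MvPolynomial (Fin 4) ℝ}
    (hH : ∀ i, (H i).IsHomogeneous (m + 3)) (hE : ∀ x, E.at x = T.baryField H x)
    (htr : ∀ a b c, a ≠ c → b ≠ c → MvPolynomial.X c ∣ T.edgeComponent H a b)
    (hint : ∀ v ∈ trimmedTwoForms T.closedInterior (((m + 3 : ℕ) : ℤ) - 2),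
      interiorMoment T E v = 0)
    (x : E3) (hx : x ∈ T.closedInterior) : E.at x = 0 := by
  have hU := T.edgeComponent_isHomogeneous hH
  have hsub : ∀ a b, T.edgeComponent H a 0 - T.edgeComponent H b 0 = T.edgeComponent H a b := by
    intro a b
    simp only [edgeComponent, ← Finset.sum_sub_distrib, map_sub]
    exact Finset.sum_congr rfl fun i _ => by ring
  obtain ⟨c, d₁, d₂, d₃, hc, hd₁, hd₂, hd₃, e₁, e₂, e₃⟩ :=
    MvPolynomial.exists_decomposition_of_tangential_trace_eq_zero (hU 1 0) (hU 2 0) (hU 3 0)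
      (htr _ _ _ (by decide) (by decide)) (htr _ _ _ (by decide) (by decide))
      (htr _ _ _ (by decide) (by decide)) (htr _ _ _ (by decide) (by decide))
      (htr _ _ _ (by decide) (by decide)) (htr _ _ _ (by decide) (by decide))
      (hsub 1 2 ▸ htr _ _ _ (by decide) (by decide)) (hsub 1 3 ▸ htr _ _ _ (by decide) (by decide))
  -- With this β and Σ λ_a = 1, the coefficient of v along x_i - x_0 is d_i + βλ_i = (λ_i c + λ_0
  -- d_i) + Σ_j (λ_j d_i - λ_i d_j), j running over 1, 2, 3. Multiplied by U_i and summed, the first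
  -- term gives squares. In the rest the c terms cancel by antisymmetry, and the λ_0 terms pair into
  -- λ_0 λ_k (λ_j d_i - λ_i d_j)².
  set β := c - d₁ - d₂ - d₃ with hβ
  have hβh : β.IsHomogeneous m := ((hc.sub hd₁).sub hd₂).sub hd₃
  -- The term -β x_0 is absorbed here, so that β multiplies the position vector x rather than x -
  -- x_0.
  let G : Fin 3 → MvPolynomial (Fin 4) ℝ := fun i =>
    MvPolynomial.C (T.points 1 i - T.points 0 i) * d₁ +
    MvPolynomial.C (T.points 2 i - T.points 0 i) * d₂ +
    MvPolynomial.C (T.points 3 i - T.points 0 i) * d₃ - MvPolynomial.C (T.points 0 i) * β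
  have hG : ∀ i, (G i).IsHomogeneous m := fun i =>
    (((hd₁.C_mul _).add (hd₂.C_mul _)).add (hd₃.C_mul _)).sub (hβh.C_mul _)
  let v : T.closedInterior → E3 := fun y =>
    T.baryField G y.1 + MvPolynomial.eval (T.bary y.1) β • y.1
  have hk : (((m + 3 : ℕ) : ℤ) - 2) - 1 = m := by push_cast; ring
  have hv : v ∈ trimmedTwoForms T.closedInterior (((m + 3 : ℕ) : ℤ) - 2) :=
    Submodule.add_mem_sup (T.baryField_mem_vecPolyOn _ hG hk)
      (Submodule.mem_map_of_mem (f := mulPosition T.closedInterior)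
        (T.eval_bary_mem_polyOn _ hβh hk))
  have hval : ∀ y : T.closedInterior, inner ℝ (E.at y.1) (v y) =
      T.bary y.1 2 * T.bary y.1 3 * (MvPolynomial.eval (T.bary y.1)
        (MvPolynomial.X 1 * c + MvPolynomial.X 0 * d₁)) ^ 2 +
      T.bary y.1 1 * T.bary y.1 3 * (MvPolynomial.eval (T.bary y.1)
        (MvPolynomial.X 2 * c + MvPolynomial.X 0 * d₂)) ^ 2 +
      T.bary y.1 1 * T.bary y.1 2 * (MvPolynomial.eval (T.bary y.1)
        (MvPolynomial.X 3 * c + MvPolynomial.X 0 * d₃)) ^ 2 +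
      T.bary y.1 0 *
        (T.bary y.1 3 * (MvPolynomial.eval (T.bary y.1)
          (MvPolynomial.X 1 * d₂ - MvPolynomial.X 2 * d₁)) ^ 2 +
        T.bary y.1 2 * (MvPolynomial.eval (T.bary y.1)
          (MvPolynomial.X 1 * d₃ - MvPolynomial.X 3 * d₁)) ^ 2 +
        T.bary y.1 1 * (MvPolynomial.eval (T.bary y.1)
          (MvPolynomial.X 2 * d₃ - MvPolynomial.X 3 * d₂)) ^ 2) := by
    rintro ⟨y, hy⟩
    have hvy : v ⟨y, hy⟩ = MvPolynomial.eval (T.bary y) d₁ • (T.points 1 - T.points 0) +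
        MvPolynomial.eval (T.bary y) d₂ • (T.points 2 - T.points 0) +
        MvPolynomial.eval (T.bary y) d₃ • (T.points 3 - T.points 0) +
        MvPolynomial.eval (T.bary y) β • (y - T.points 0) := by
      ext i
      simp only [v, G, PiLp.add_apply, PiLp.smul_apply, PiLp.sub_apply, baryField_apply, map_add,
        map_sub, map_mul, MvPolynomial.eval_C, smul_eq_mul]
      ring
    rw [hvy, T.sub_points_zero_eq y]
    simp only [inner_add_right, real_inner_smul_right, hE, ← eval_edgeComponent, e₁, e₂, e₃, hβ,
      map_add, map_sub, map_mul, MvPolynomial.eval_X]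
    have hs := T.sum_bary y
    rw [Fin.sum_univ_four] at hs
    rw [show T.bary y 0 = 1 - T.bary y 1 - T.bary y 2 - T.bary y 3 by linarith]
    ring
  have hpos : ∀ {a b r : ℝ}, 0 ≤ a → 0 ≤ b → 0 ≤ a * b * r ^ 2 := fun ha hb =>
    mul_nonneg (mul_nonneg ha hb) (sq_nonneg _)
  have hlast : ∀ {a b c d r s t : ℝ}, 0 ≤ a → 0 ≤ b → 0 ≤ c → 0 ≤ d →
      0 ≤ a * (b * r ^ 2 + c * s ^ 2 + d * t ^ 2) := fun ha hb hc hd => by positivity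
  have hz := eq_zero_of_integral_simplexMeasure_eq_zero T (g := fun y => inner ℝ (E.at y.1) (v y))
    ((E.continuous_at_comp _).inner (continuous_of_mem_trimmedTwoForms hv))
    (fun y => by
      have hy := T.mem_closedInterior_iff.1 y.2
      rw [hval y]
      exact add_nonneg (add_nonneg (add_nonneg (hpos (hy _) (hy _)) (hpos (hy _) (hy _)))
        (hpos (hy _) (hy _))) (hlast (hy _) (hy _) (hy _) (hy _)))
    (hint v hv) ⟨x, hx⟩
  have hx' := T.mem_closedInterior_iff.1 hx
  rw [hval ⟨x, hx⟩] at hz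
  have t₁ := @hpos _ _ (MvPolynomial.eval (T.bary x)
    (MvPolynomial.X 1 * c + MvPolynomial.X 0 * d₁)) (hx' 2) (hx' 3)
  have t₂ := @hpos _ _ (MvPolynomial.eval (T.bary x)
    (MvPolynomial.X 2 * c + MvPolynomial.X 0 * d₂)) (hx' 1) (hx' 3)
  have t₃ := @hpos _ _ (MvPolynomial.eval (T.bary x)
    (MvPolynomial.X 3 * c + MvPolynomial.X 0 * d₃)) (hx' 1) (hx' 2)
  have t₄ := @hlast _ _ _ _ (MvPolynomial.eval (T.bary x)
      (MvPolynomial.X 1 * d₂ - MvPolynomial.X 2 * d₁)) (MvPolynomial.eval (T.bary x)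
      (MvPolynomial.X 1 * d₃ - MvPolynomial.X 3 * d₁)) (MvPolynomial.eval (T.bary x)
      (MvPolynomial.X 2 * d₃ - MvPolynomial.X 3 * d₂)) (hx' 0) (hx' 3) (hx' 2) (hx' 1)
  dsimp only at hz
  -- All weighted squares are nonnegative with sum zero. The first three suffice: λ_j λ_k r² = 0
  -- gives U_i = λ_j λ_k r = 0.
  have hzero : ∀ {a b r : ℝ}, a * b * r ^ 2 = 0 → a * (b * r) = 0 := fun {a b r} h => by
    rcases mul_eq_zero.1 h with h | h
    · rw [← mul_assoc, h, zero_mul]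
    · rw [pow_eq_zero_iff two_ne_zero |>.1 h, mul_zero, mul_zero]
  refine T.eq_zero_of_inner_sub_points_eq_zero ?_ ?_ ?_
  · rw [hE, ← eval_edgeComponent, e₁, map_mul, map_mul, MvPolynomial.eval_X, MvPolynomial.eval_X]
    exact hzero (by linarith)
  · rw [hE, ← eval_edgeComponent, e₂, map_mul, map_mul, MvPolynomial.eval_X, MvPolynomial.eval_X]
    exact hzero (by linarith)
  · rw [hE, ← eval_edgeComponent, e₃, map_mul, map_mul, MvPolynomial.eval_X, MvPolynomial.eval_X]
    exact hzero (by linarith)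

/-- A vector polynomial all of whose degrees of freedom vanish is zero. -/
theorem eq_zero_of_dofs_eq_zero {m : ℕ} {n : TetFace → E3}
    (hn : ∀ f, IsUnitNormal (tetFace T f) (n f)) {E : VecPoly (m + 3)}
    (hv : ∀ a i, E.at (T.points a) i = 0) (hd : ∀ a i j, E.derivAt i j (T.points a) = 0)
    (he : ∀ e i, ∀ q ∈ polyOn (tetEdge T e).closedInterior (((m + 3 : ℕ) : ℤ) - 4),
      edgeMoment T E e i q = 0)
    (hf : ∀ f, ∀ q ∈ tangentPolyOn (tetFace T f) (((m + 3 : ℕ) : ℤ) - 3),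
      faceMoment T E f (n f) q = 0)
    (ht : ∀ v ∈ trimmedTwoForms T.closedInterior (((m + 3 : ℕ) : ℤ) - 2),
      interiorMoment T E v = 0) : E = 0 := by
  choose H hH hHE using fun i => T.exists_isHomogeneous_baryMap_eq (E i).2
  have hE : ∀ x, E.at x = T.baryField H x := fun x => by
    ext i
    rw [baryField_apply, ← eval_baryMap, hHE]
    rfl
  have hedge : ∀ S : Finset (Fin 4), S.card = 2 → ∀ i, MvPolynomial.killOutside S (H i) = 0 := by
    intro S hS i
    refine T.killOutside_eq_zero_of_eval (hH i) (Finset.card_pos.1 (by omega)) fun x h0 h1 => ?_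
    rw [← eval_baryMap, hHE]
    exact T.eval_eq_zero_on_edge (mem_polySpace_natCast.1 (E i).2) (fun a => hv a i)
      (fun a j => hd a i j) ⟨S, hS⟩ (fun q hq => he ⟨S, hS⟩ i q hq) x
      ((T.mem_closedInterior_face_iff hS).2 ⟨h0, h1⟩)
  have htr : ∀ a b c, a ≠ c → b ≠ c → MvPolynomial.X c ∣ T.edgeComponent H a b := by
    intro a b c hac hbc
    have hS : (Finset.univ.erase c).card = 3 := by
      rw [Finset.card_erase_of_mem (Finset.mem_univ c)]; rfl
    -- The edge from b to a lies in the face opposite c, so the component of E along it is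
    -- tangential there.
    refine MvPolynomial.X_dvd_of_killOutside_eq_zero (T.killOutside_eq_zero_of_eval
      (T.edgeComponent_isHomogeneous hH a b) (Finset.card_pos.1 (by omega)) fun x h0 h1 => ?_)
    rw [eval_edgeComponent, ← hE]
    have hfn := hn ⟨_, hS⟩
    refine inner_eq_zero_of_cross_eq_zero hfn.1 (hfn.2 _ ?_)
      (T.cross_eq_zero_on_face hH hE hedge ⟨_, hS⟩ hfn (hf _) x
        ((T.mem_closedInterior_face_iff hS).2 ⟨h0, h1⟩))
    have hmem : ∀ a, a ≠ c → T.points a ∈ affineSpan ℝ (Set.range (T.face hS).points) := by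
      intro a ha
      rw [range_face_points]
      exact subset_affineSpan ℝ _ ⟨a, by simpa using ha, rfl⟩
    exact AffineSubspace.vsub_mem_direction (hmem a hac) (hmem b hbc)
  have hzero := T.eq_zero_of_interiorMoment_eq_zero hH hE htr ht
  funext i
  refine Subtype.ext ?_
  rw [← hHE i]
  have hk : MvPolynomial.killOutside Finset.univ (H i) = 0 := by
    refine T.killOutside_eq_zero_of_eval (hH i) Finset.univ_nonempty fun x h0 _ => ?_
    have := congrArg (fun u : E3 => u i) (hzero x (T.mem_closedInterior_iff.2 h0))
    rw [hE] at this
    exact this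
  refine eq_of_eval_ofLp_eq fun x => ?_
  rw [eval_baryMap, eval_eq_zero_of_killOutside_eq_zero T hk (by simp)]
  exact (map_zero _).symm

end Affine.Simplex

/-! ### Dimensions of the polynomial and test spaces -/

theorem finrank_homogeneousSubmodule (k m : ℕ) :
    Module.finrank ℝ (MvPolynomial.homogeneousSubmodule (Fin k) ℝ m) = k.multichoose m := by
  rw [MvPolynomial.homogeneousSubmodule_eq_finsupp_supported]
  have h := Module.finrank_eq_nat_card_basis
    (MvPolynomial.basisRestrictSupport ℝ {d : Fin k →₀ ℕ | d.degree = m})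
  have hset : {d : Fin k →₀ ℕ | d.degree = m} = ((Finset.univ.finsuppAntidiag m : Finset (Fin k →₀ ℕ)) : Set _) := by
    ext d
    simp [Finsupp.degree_eq_sum]
  refine h.trans ?_
  rw [Nat.card_coe_set_eq, hset, Set.ncard_coe_finset,
    Finset.card_finsuppAntidiag_nat_eq_multichoose, Finset.card_univ, Fintype.card_fin]

instance finiteDimensional_polySpace (m : ℤ) : FiniteDimensional ℝ (polySpace m) := by
  have hfin : {d : Fin 3 →₀ ℕ | ((Finsupp.degree d : ℕ) : ℤ) ≤ m}.Finite := by
    refine (Finsupp.finite_of_degree_le (σ := Fin 3) m.toNat).subset fun d hd => ?_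
    have : ((Finsupp.degree d : ℕ) : ℤ) ≤ m := hd
    show Finsupp.degree d ≤ m.toNat
    omega
  have : Finite {d : Fin 3 →₀ ℕ | ((Finsupp.degree d : ℕ) : ℤ) ≤ m} := hfin
  exact (MvPolynomial.basisRestrictSupport ℝ
    {d : Fin 3 →₀ ℕ | ((Finsupp.degree d : ℕ) : ℤ) ≤ m}).finiteDimensional_of_finite

instance finiteDimensional_polyOn (S : Set E3) (m : ℤ) : FiniteDimensional ℝ (polyOn S m) :=
  inferInstanceAs (FiniteDimensional ℝ ((polySpace m).map (restrictTo S)))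

theorem polyOn_of_neg (S : Set E3) {m : ℤ} (hm : m < 0) : polyOn S m = ⊥ := by
  rw [polyOn, polySpace_of_neg hm, Submodule.map_bot]

/-- The components of a polynomial vector field. -/
noncomputable def vecPolyOnComponents (S : Set E3) (m : ℤ) :
    vecPolyOn S m →ₗ[ℝ] (Fin 3 → polyOn S m) where
  toFun q i := ⟨fun x => q.1 x i, q.2 i⟩
  map_add' _ _ := rfl
  map_smul' _ _ := rfl

theorem vecPolyOnComponents_injective (S : Set E3) (m : ℤ) :
    Function.Injective (vecPolyOnComponents S m) := by
  intro q r h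
  ext x i
  exact congrFun (congrArg Subtype.val (congrFun h i)) x

instance finiteDimensional_vecPolyOn (S : Set E3) (m : ℤ) : FiniteDimensional ℝ (vecPolyOn S m) :=
  FiniteDimensional.of_injective _ (vecPolyOnComponents_injective S m)

theorem finrank_vecPolyOn_le (S : Set E3) (m : ℤ) :
    Module.finrank ℝ (vecPolyOn S m) ≤ 3 * Module.finrank ℝ (polyOn S m) := by
  have := LinearMap.finrank_le_finrank_of_injective (vecPolyOnComponents_injective S m)
  simpa [Module.finrank_pi_fintype] using this

theorem inner_mem_polyOn {S : Set E3} {m : ℤ} {q : S → E3} (hq : q ∈ vecPolyOn S m) (w : E3) :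
    (fun x => inner ℝ w (q x)) ∈ polyOn S m := by
  have := (polyOn S m).add_mem ((polyOn S m).add_mem ((polyOn S m).smul_mem (w 0) (hq 0))
    ((polyOn S m).smul_mem (w 1) (hq 1))) ((polyOn S m).smul_mem (w 2) (hq 2))
  convert this using 1
  funext x
  rw [inner_E3]
  rfl

/-- Coordinates in an orthonormal basis of the plane use two scalar polynomials; the three Cartesian
components would give too weak a dimension bound. -/
theorem exists_injective_tangentPolyOn (F : Affine.Simplex ℝ E3 2) (m : ℤ) :
    ∃ φ : tangentPolyOn F m →ₗ[ℝ] (Fin 2 → polyOn F.closedInterior m), Function.Injective φ := by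
  have hfin : Module.finrank ℝ (affineSpan ℝ (Set.range F.points)).direction = 2 := by
    rw [direction_affineSpan]
    exact F.independent.finrank_vectorSpan (by simp)
  let b := (stdOrthonormalBasis ℝ (affineSpan ℝ (Set.range F.points)).direction).reindex
    (finCongr hfin)
  refine ⟨⟨⟨fun q i => ⟨fun x => inner ℝ (b i : E3) (q.1 x), inner_mem_polyOn q.2.1 _⟩, ?_⟩, ?_⟩, ?_⟩
  · intro q r
    ext i x
    exact inner_add_right _ _ _
  · intro c q
    ext i x
    exact real_inner_smul_right _ _ _
  · intro q r h
    refine Subtype.ext (funext fun x => ?_)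
    have key : (⟨q.1 x, q.2.2 x⟩ : (affineSpan ℝ (Set.range F.points)).direction) =
        ⟨r.1 x, r.2.2 x⟩ := by
      refine b.repr.injective ?_
      ext i
      rw [b.repr_apply_apply, b.repr_apply_apply]
      exact congrFun (congrArg Subtype.val (congrFun h i)) x
    exact congrArg Subtype.val key

instance finiteDimensional_tangentPolyOn (F : Affine.Simplex ℝ E3 2) (m : ℤ) :
    FiniteDimensional ℝ (tangentPolyOn F m) := by
  obtain ⟨φ, hφ⟩ := exists_injective_tangentPolyOn F m
  exact FiniteDimensional.of_injective φ hφ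

theorem finrank_tangentPolyOn_le (F : Affine.Simplex ℝ E3 2) (m : ℤ) :
    Module.finrank ℝ (tangentPolyOn F m) ≤ 2 * Module.finrank ℝ (polyOn F.closedInterior m) := by
  obtain ⟨φ, hφ⟩ := exists_injective_tangentPolyOn F m
  simpa [Module.finrank_pi_fintype] using LinearMap.finrank_le_finrank_of_injective hφ

instance finiteDimensional_trimmedTwoForms (S : Set E3) (r : ℤ) :
    FiniteDimensional ℝ (trimmedTwoForms S r) :=
  inferInstanceAs (FiniteDimensional ℝ
    ↥(vecPolyOn S (r - 1) ⊔ (polyOn S (r - 1)).map (mulPosition S)))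

/-- If b has degree below m, then b x already has components of degree at most m. Only the top
homogeneous part of b contributes anything new, which keeps the bound sharp. -/
theorem trimmedTwoForms_le (S : Set E3) {r : ℤ} {m : ℕ} (hr : r - 1 = m) :
    trimmedTwoForms S r ≤ vecPolyOn S (m : ℤ) ⊔
      (MvPolynomial.homogeneousSubmodule (Fin 3) ℝ m).map (mulPosition S ∘ₗ restrictTo S) := by
  rw [trimmedTwoForms, hr, polyOn, ← Submodule.map_comp]
  refine sup_le le_sup_left ?_
  rw [Submodule.map_le_iff_le_comap, polySpace, MvPolynomial.restrictSupport_eq_span,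
    Submodule.span_le]
  rintro _ ⟨d, hd, rfl⟩
  have hd' : Finsupp.degree d ≤ m := by exact_mod_cast hd
  rcases hd'.eq_or_lt with h | h
  · exact Submodule.mem_sup_right (Submodule.mem_map_of_mem
      (MvPolynomial.isHomogeneous_monomial 1 h))
  · refine Submodule.mem_sup_left fun i => ?_
    refine ⟨MvPolynomial.monomial d 1 * MvPolynomial.X i, ?_, ?_⟩
    · refine mem_polySpace_natCast.2 ((MvPolynomial.totalDegree_mul _ _).trans ?_)
      rw [MvPolynomial.totalDegree_X]
      have := (MvPolynomial.isHomogeneous_monomial (R := ℝ) 1 (rfl : d.degree = _)).totalDegree_le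
      omega
    · funext x
      rw [restrictTo_apply, map_mul, MvPolynomial.eval_X]
      rfl

theorem finrank_trimmedTwoForms_le (S : Set E3) {r : ℤ} {m : ℕ} (hr : r - 1 = m) :
    Module.finrank ℝ (trimmedTwoForms S r) ≤
      3 * Module.finrank ℝ (polyOn S (m : ℤ)) + Nat.multichoose 3 m := by
  have : FiniteDimensional ℝ (MvPolynomial.homogeneousSubmodule (Fin 3) ℝ m) :=
    Module.Finite.iff_fg.2 (MvPolynomial.homogeneousSubmodule_fg _ _ m)
  refine (Submodule.finrank_mono (trimmedTwoForms_le S hr)).trans ?_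
  refine (Submodule.finrank_add_le_finrank_add_finrank _ _).trans ?_
  refine add_le_add (finrank_vecPolyOn_le S m) ?_
  rw [← finrank_homogeneousSubmodule]
  exact Submodule.finrank_map_le _ _

namespace Affine.Simplex

variable (T : Affine.Simplex ℝ E3 3)

/-- Restrictions to K are spanned by the degree m monomials in the barycentric coordinates labelled
by S, since any other monomial contains a factor vanishing on K. -/
theorem finrank_polyOn_le {K : Set E3} {S : Finset (Fin 4)}
    (hK : ∀ x ∈ K, ∀ a ∉ S, T.bary x a = 0) (m : ℕ) :
    Module.finrank ℝ (polyOn K (m : ℤ)) ≤ S.card.multichoose m := by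
  classical
  let φ : MvPolynomial (Fin 4) ℝ →ₗ[ℝ] (K → ℝ) := restrictTo K ∘ₗ T.baryMap.toLinearMap
  let B : Finset (K → ℝ) := (S.finsuppAntidiag m).image fun d => φ (MvPolynomial.monomial d 1)
  have hle : polyOn K (m : ℤ) ≤ Submodule.span ℝ B := by
    rintro _ ⟨P, hP, rfl⟩
    obtain ⟨H, hH, rfl⟩ := T.exists_isHomogeneous_baryMap_eq hP
    change φ H ∈ _
    rw [H.as_sum, map_sum]
    refine Submodule.sum_mem _ fun d hd => ?_
    have hdeg := hH.degree_eq_sum_deg_support hd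
    by_cases hdS : d.support ⊆ S
    · have : MvPolynomial.monomial d (MvPolynomial.coeff d H) =
          MvPolynomial.coeff d H • MvPolynomial.monomial d (1 : ℝ) := by
        rw [MvPolynomial.smul_monomial, smul_eq_mul, mul_one]
      rw [this, map_smul]
      refine Submodule.smul_mem _ _ (Submodule.subset_span ?_)
      refine Finset.mem_coe.2 (Finset.mem_image_of_mem _ (Finset.mem_finsuppAntidiag.2 ⟨?_, hdS⟩))
      rw [hdeg]
      exact (Finset.sum_subset hdS fun a _ ha => by simpa using ha).symm
    · obtain ⟨a, ha, haS⟩ := Finset.not_subset.1 hdS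
      have : φ (MvPolynomial.monomial d (MvPolynomial.coeff d H)) = 0 := by
        funext x
        change MvPolynomial.eval x.1.ofLp (T.baryMap _) = 0
        rw [eval_baryMap, MvPolynomial.eval_monomial, Finsupp.prod,
          Finset.prod_eq_zero ha, mul_zero]
        rw [hK x.1 x.2 a haS, zero_pow (Finsupp.mem_support_iff.1 ha)]
      rw [this]
      exact Submodule.zero_mem _
  refine (Submodule.finrank_mono hle).trans ((finrank_span_finset_le_card B).trans ?_)
  rw [← Finset.card_finsuppAntidiag_nat_eq_multichoose]
  exact Finset.card_image_le

theorem finrank_polyOn_face_le {S : Finset (Fin 4)} {k : ℕ} (h : S.card = k + 1) (m : ℕ) :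
    Module.finrank ℝ (polyOn (T.face h).closedInterior (m : ℤ)) ≤ (k + 1).multichoose m := by
  have := T.finrank_polyOn_le (S := S)
    (fun x hx => ((T.mem_closedInterior_face_iff h).1 hx).2) m
  rwa [h] at this

/-- Substituting barycentric coordinates is injective on homogeneous polynomials of a fixed degree,
by the cone argument. -/
theorem le_finrank_polySpace (T : Affine.Simplex ℝ E3 3) (m : ℕ) :
    Nat.multichoose 4 m ≤ Module.finrank ℝ (polySpace (m : ℤ)) := by
  rw [← finrank_homogeneousSubmodule]
  let φ : MvPolynomial.homogeneousSubmodule (Fin 4) ℝ m →ₗ[ℝ] polySpace (m : ℤ) :=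
    (T.baryMap.toLinearMap.comp (Submodule.subtype _)).codRestrict _
      fun H => T.baryMap_mem_polySpace H.2
  have hφ : Function.Injective φ := by
    refine (injective_iff_map_eq_zero φ).2 fun H hH => ?_
    have h0 : T.baryMap H.1 = 0 := congrArg Subtype.val hH
    have h1 : MvPolynomial.killOutside Finset.univ H.1 = 0 :=
      T.killOutside_eq_zero_of_eval H.2 Finset.univ_nonempty fun x _ _ => by
        rw [← eval_baryMap, h0, map_zero]
    refine Subtype.ext (MvPolynomial.funext fun μ => ?_)
    rw [← MvPolynomial.eval_killOutside_of_support (S := Finset.univ) (by simp), h1]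
    rfl
  exact LinearMap.finrank_le_finrank_of_injective hφ

end Affine.Simplex

/-! ### The degrees of freedom as one linear map -/

theorem VecPoly.add_at {p : ℕ} (E E' : VecPoly p) (x : E3) : (E + E').at x = E.at x + E'.at x := by
  ext i
  exact map_add (MvPolynomial.eval x.ofLp) (E i).1 (E' i).1

theorem VecPoly.smul_at {p : ℕ} (c : ℝ) (E : VecPoly p) (x : E3) : (c • E).at x = c • E.at x := by
  ext i
  exact MvPolynomial.smul_eval x.ofLp (E i).1 c

theorem cross_add_left (u v w : E3) : cross (u + v) w = cross u w + cross v w := by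
  simp [cross]

section Functionals

variable (T : Affine.Simplex ℝ E3 3) (p : ℕ)

theorem integrable_edgeMoment {p : ℕ} (E : VecPoly p) (e : TetEdge) (i : Fin 3) {m : ℤ}
    (q : polyOn (tetEdge T e).closedInterior m) :
    Integrable (fun x => E.at x.1 i * q.1 x) (simplexMeasure (tetEdge T e)) :=
  integrable_simplexMeasure _ ((((continuous_eval_ofLp (E i).1).comp continuous_subtype_val).mul
    (continuous_of_mem_polyOn q.2)))

/-- The edge moments as linear functionals of the test function. -/
noncomputable def edgeDof (e : TetEdge) (i : Fin 3) :
    VecPoly p →ₗ[ℝ] Module.Dual ℝ (polyOn (tetEdge T e).closedInterior ((p : ℤ) - 4)) :=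
  LinearMap.mk₂ ℝ (fun E q => edgeMoment T E e i q.1)
    (fun E E' q => by
      rw [edgeMoment, edgeMoment, edgeMoment, ← integral_add (integrable_edgeMoment T E e i q)
        (integrable_edgeMoment T E' e i q)]
      simp only [VecPoly.add_at, PiLp.add_apply, add_mul])
    (fun c E q => by
      rw [edgeMoment, edgeMoment, smul_eq_mul, ← integral_const_mul]
      simp only [VecPoly.smul_at, PiLp.smul_apply, smul_eq_mul, mul_assoc])
    (fun E q q' => by
      rw [edgeMoment, edgeMoment, edgeMoment, ← integral_add (integrable_edgeMoment T E e i q)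
        (integrable_edgeMoment T E e i q')]
      simp only [Submodule.coe_add, Pi.add_apply, mul_add])
    (fun c E q => by
      rw [edgeMoment, edgeMoment, smul_eq_mul, ← integral_const_mul]
      simp only [Submodule.coe_smul, Pi.smul_apply, smul_eq_mul, mul_left_comm])

theorem integrable_faceMoment {p : ℕ} (E : VecPoly p) (f : TetFace) (n : E3) {m : ℤ}
    (q : tangentPolyOn (tetFace T f) m) :
    Integrable (fun x => inner ℝ (cross (E.at x.1) n) (q.1 x)) (simplexMeasure (tetFace T f)) :=
  integrable_simplexMeasure _ (((continuous_cross_left n).comp (E.continuous_at_comp _)).inner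
    (continuous_of_mem_vecPolyOn q.2.1))

/-- The face moments as linear functionals of the test field. -/
noncomputable def faceDof (n : E3) (f : TetFace) :
    VecPoly p →ₗ[ℝ] Module.Dual ℝ (tangentPolyOn (tetFace T f) ((p : ℤ) - 3)) :=
  LinearMap.mk₂ ℝ (fun E q => faceMoment T E f n q.1)
    (fun E E' q => by
      rw [faceMoment, faceMoment, faceMoment, ← integral_add (integrable_faceMoment T E f n q)
        (integrable_faceMoment T E' f n q)]
      simp only [VecPoly.add_at, cross_add_left, inner_add_left])
    (fun c E q => by
      rw [faceMoment, faceMoment, smul_eq_mul, ← integral_const_mul]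
      simp only [VecPoly.smul_at, cross_smul_left, real_inner_smul_left])
    (fun E q q' => by
      rw [faceMoment, faceMoment, faceMoment, ← integral_add (integrable_faceMoment T E f n q)
        (integrable_faceMoment T E f n q')]
      simp only [Submodule.coe_add, Pi.add_apply, inner_add_right])
    (fun c E q => by
      rw [faceMoment, faceMoment, smul_eq_mul, ← integral_const_mul]
      simp only [Submodule.coe_smul, Pi.smul_apply, real_inner_smul_right])

theorem integrable_interiorMoment {p : ℕ} (E : VecPoly p) {r : ℤ}
    (v : trimmedTwoForms T.closedInterior r) :
    Integrable (fun x => inner ℝ (E.at x.1) (v.1 x)) (simplexMeasure T) :=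
  integrable_simplexMeasure _ ((E.continuous_at_comp _).inner
    (continuous_of_mem_trimmedTwoForms v.2))

/-- The interior moments as linear functionals of the test field. -/
noncomputable def interiorDof :
    VecPoly p →ₗ[ℝ] Module.Dual ℝ (trimmedTwoForms T.closedInterior ((p : ℤ) - 2)) :=
  LinearMap.mk₂ ℝ (fun E v => interiorMoment T E v.1)
    (fun E E' v => by
      rw [interiorMoment, interiorMoment, interiorMoment,
        ← integral_add (integrable_interiorMoment T E v) (integrable_interiorMoment T E' v)]
      simp only [VecPoly.add_at, inner_add_left])
    (fun c E v => by
      rw [interiorMoment, interiorMoment, smul_eq_mul, ← integral_const_mul]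
      simp only [VecPoly.smul_at, real_inner_smul_left])
    (fun E v v' => by
      rw [interiorMoment, interiorMoment, interiorMoment,
        ← integral_add (integrable_interiorMoment T E v) (integrable_interiorMoment T E v')]
      simp only [Submodule.coe_add, Pi.add_apply, inner_add_right])
    (fun c E v => by
      rw [interiorMoment, interiorMoment, smul_eq_mul, ← integral_const_mul]
      simp only [Submodule.coe_smul, Pi.smul_apply, real_inner_smul_right])

/-- The vertex values. -/
noncomputable def vertexValueDof : VecPoly p →ₗ[ℝ] (Fin 4 → Fin 3 → ℝ) where
  toFun E a i := E.at (T.points a) i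
  map_add' E E' := by
    funext a i
    simp [VecPoly.add_at]
  map_smul' c E := by
    funext a i
    simp [VecPoly.smul_at]

/-- The first partial derivatives at the vertices. -/
noncomputable def vertexDerivDof : VecPoly p →ₗ[ℝ] (Fin 4 → Fin 3 → Fin 3 → ℝ) where
  toFun E a i j := E.derivAt i j (T.points a)
  map_add' E E' := by
    funext a i j
    simp [VecPoly.derivAt]
  map_smul' c E := by
    funext a i j
    simp [VecPoly.derivAt]

/-- The space of prescribed values of the degrees of freedom. -/
abbrev DofSpace : Type :=
  (Fin 4 → Fin 3 → ℝ) × (Fin 4 → Fin 3 → Fin 3 → ℝ) ×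
  ((e : TetEdge) → Fin 3 → Module.Dual ℝ (polyOn (tetEdge T e).closedInterior ((p : ℤ) - 4))) ×
  ((f : TetFace) → Module.Dual ℝ (tangentPolyOn (tetFace T f) ((p : ℤ) - 3))) ×
  Module.Dual ℝ (trimmedTwoForms T.closedInterior ((p : ℤ) - 2))

instance finiteDimensional_edgeDofs : FiniteDimensional ℝ ((e : TetEdge) → Fin 3 →
    Module.Dual ℝ (polyOn (tetEdge T e).closedInterior ((p : ℤ) - 4))) :=
  have (e : TetEdge) : FiniteDimensional ℝ (Fin 3 →
      Module.Dual ℝ (polyOn (tetEdge T e).closedInterior ((p : ℤ) - 4))) := inferInstance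
  Module.Finite.pi

instance finiteDimensional_faceDofs : FiniteDimensional ℝ ((f : TetFace) →
    Module.Dual ℝ (tangentPolyOn (tetFace T f) ((p : ℤ) - 3))) :=
  Module.Finite.pi

instance finiteDimensional_dofSpace : FiniteDimensional ℝ (DofSpace T p) :=
  Module.Finite.prod

/-- The map which takes a vector polynomial to its degrees of freedom. -/
noncomputable def dofMap (n : TetFace → E3) : VecPoly p →ₗ[ℝ] DofSpace T p :=
  (vertexValueDof T p).prod <| (vertexDerivDof T p).prod <|
    (LinearMap.pi fun e => LinearMap.pi fun i => edgeDof T p e i).prod <|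
    (LinearMap.pi fun f => faceDof T p (n f) f).prod (interiorDof T p)

variable {T p}

theorem isAttainedBy_iff {D : DofData T p} {n : TetFace → E3} {E : VecPoly p} :
    D.IsAttainedBy n E ↔
      dofMap T p n E = (D.vertexValue, D.vertexDeriv, D.edge, D.face, D.interior) := by
  constructor
  · intro h
    refine Prod.ext ?_ (Prod.ext ?_ (Prod.ext ?_ (Prod.ext ?_ ?_)))
    · exact funext₂ h.vertexValue
    · exact funext₃ h.vertexDeriv
    · exact funext₂ fun e i => LinearMap.ext (h.edge e i)
    · exact funext fun f => LinearMap.ext (h.face f)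
    · exact LinearMap.ext h.interior
  · intro h
    simp only [Prod.ext_iff] at h
    exact ⟨fun a i => congrFun₂ h.1 a i, fun a i j => congrFun₃ h.2.1 a i j,
      fun e i q => LinearMap.congr_fun (congrFun₂ h.2.2.1 e i) q,
      fun f q => LinearMap.congr_fun (congrFun h.2.2.2.1 f) q,
      fun v => LinearMap.congr_fun h.2.2.2.2 v⟩

end Functionals

/-! ### Dimension count and unisolvence -/

theorem dofMap_injective (T : Affine.Simplex ℝ E3 3) (m : ℕ) {n : TetFace → E3}
    (hn : ∀ f, IsUnitNormal (tetFace T f) (n f)) : Function.Injective (dofMap T (m + 3) n) := by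
  refine (injective_iff_map_eq_zero _).2 fun E hE => ?_
  have h : (⟨0, 0, 0, 0, 0⟩ : DofData T (m + 3)).IsAttainedBy n E := isAttainedBy_iff.2 hE
  exact T.eq_zero_of_dofs_eq_zero hn h.vertexValue h.vertexDeriv
    (fun e i q hq => h.edge e i ⟨q, hq⟩) (fun f q hq => h.face f ⟨q, hq⟩)
    (fun v hv => h.interior ⟨v, hv⟩)

theorem finrank_polyOn_tetEdge_le (T : Affine.Simplex ℝ E3 3) (m : ℕ) (e : TetEdge) :
    Module.finrank ℝ (polyOn (tetEdge T e).closedInterior (((m + 3 : ℕ) : ℤ) - 4)) ≤ m := by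
  -- For m = 0 the degree is -1 and the space is zero; otherwise the dimension is one more than the
  -- degree.
  rcases m with _ | m
  · rw [polyOn_of_neg _ (by norm_num), finrank_bot]
  · rw [show (((m + 1 + 3 : ℕ) : ℤ) - 4) = m by push_cast; ring]
    exact (T.finrank_polyOn_face_le e.2 m).trans_eq (Nat.multichoose_two m)

theorem card_tetEdge : Fintype.card TetEdge = 6 := by decide

theorem card_tetFace : Fintype.card TetFace = 4 := by decide

/-- Write h_k for the number of degree m monomials in k variables, p = m + 3. The data number at
most 12 + 36 + 18m + 8h_3 + (3h_4 + h_3), while three applications of Pascal's rule in each of two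
ranks expand the dimension of the vector polynomials to at least the same number. -/
theorem finrank_dofSpace_le (T : Affine.Simplex ℝ E3 3) (m : ℕ) :
    Module.finrank ℝ (DofSpace T (m + 3)) ≤ Module.finrank ℝ (VecPoly (m + 3)) := by
  have hV : Module.finrank ℝ (VecPoly (m + 3)) =
      3 * Module.finrank ℝ (polySpace ((m + 3 : ℕ) : ℤ)) := by
    simp [VecPoly, Module.finrank_pi_fintype]
  have hW : Module.finrank ℝ (DofSpace T (m + 3)) = 12 + (36 +
      ((∑ e : TetEdge, 3 * Module.finrank ℝ
        (polyOn (tetEdge T e).closedInterior (((m + 3 : ℕ) : ℤ) - 4))) +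
      ((∑ f : TetFace, Module.finrank ℝ (tangentPolyOn (tetFace T f) (((m + 3 : ℕ) : ℤ) - 3))) +
      Module.finrank ℝ (trimmedTwoForms T.closedInterior (((m + 3 : ℕ) : ℤ) - 2))))) := by
    simp only [DofSpace, Module.finrank_prod, Module.finrank_pi_fintype,
      Subspace.dual_finrank_eq, Module.finrank_self, Finset.sum_const, Finset.card_univ,
      Fintype.card_fin, smul_eq_mul]
  have he : ∑ e : TetEdge, 3 * Module.finrank ℝ
      (polyOn (tetEdge T e).closedInterior (((m + 3 : ℕ) : ℤ) - 4)) ≤ 6 * (3 * m) := by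
    refine (Finset.sum_le_card_nsmul _ _ (3 * m) fun e _ =>
      Nat.mul_le_mul_left 3 (finrank_polyOn_tetEdge_le T m e)).trans_eq ?_
    rw [Finset.card_univ, card_tetEdge, smul_eq_mul]
  have hf : ∑ f : TetFace, Module.finrank ℝ
      (tangentPolyOn (tetFace T f) (((m + 3 : ℕ) : ℤ) - 3)) ≤ 4 * (2 * Nat.multichoose 3 m) := by
    refine (Finset.sum_le_card_nsmul _ _ (2 * Nat.multichoose 3 m) fun f _ => ?_).trans_eq ?_
    · rw [show (((m + 3 : ℕ) : ℤ) - 3) = m by push_cast; ring]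
      exact (finrank_tangentPolyOn_le _ _).trans
        (Nat.mul_le_mul_left 2 (T.finrank_polyOn_face_le f.2 m))
    · rw [Finset.card_univ, card_tetFace, smul_eq_mul]
  have ht : Module.finrank ℝ (trimmedTwoForms T.closedInterior (((m + 3 : ℕ) : ℤ) - 2)) ≤
      3 * Nat.multichoose 4 m + Nat.multichoose 3 m := by
    refine (finrank_trimmedTwoForms_le (m := m) _ (by push_cast; ring)).trans
      (Nat.add_le_add_right (Nat.mul_le_mul_left 3 ?_) _)
    exact T.finrank_polyOn_le (S := Finset.univ) (fun x _ a ha => absurd (Finset.mem_univ a) ha) m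
  have hp := T.le_finrank_polySpace (m + 3)
  have h4 : ∀ k, Nat.multichoose 4 (k + 1) = Nat.multichoose 3 (k + 1) + Nat.multichoose 4 k :=
    fun k => Nat.multichoose_succ_succ 3 k
  have h3 : ∀ k, Nat.multichoose 3 (k + 1) = (k + 2) + Nat.multichoose 3 k := fun k => by
    rw [Nat.multichoose_succ_succ 2 k, Nat.multichoose_two]
  rw [h4, h4, h4, h3, h3, h3] at hp
  rw [hV, hW]
  omega

theorem mainTheorem4 (p : ℕ) (hp : 3 ≤ p) (T : Affine.Simplex ℝ E3 3)
    (n : TetFace → E3) (hn : ∀ f, IsUnitNormal (tetFace T f) (n f)) (D : DofData T p) :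
    ∃! E : VecPoly p, D.IsAttainedBy n E := by
  obtain ⟨m, rfl⟩ := Nat.exists_eq_add_of_le' hp
  have hinj := dofMap_injective T m hn
  have hfin := le_antisymm (LinearMap.finrank_le_finrank_of_injective hinj)
    (finrank_dofSpace_le T m)
  have hsurj := (LinearMap.injective_iff_surjective_of_finrank_eq_finrank hfin).1 hinj
  simp_rw [isAttainedBy_iff]
  exact (show Function.Bijective (dofMap T (m + 3) n) from ⟨hinj, hsurj⟩).existsUnique _
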